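/- Let $p$ be an odd prime, $\xi=e^{2\pi i/p}$, and for $\tau$ in the upper half plane let $q=e^{2\pi i\tau}$, $q^{1/8}=e^{2\pi i\tau/8}$ and $$\theta(z,\tau)=q^{1/8}\,(2\sin\pi z)\prod_{l\ge1}(1-q^l)\prod_{l\ge1}(1-q^le^{2\pi iz})(1-q^le^{-2\pi iz}).$$ The function $\theta(\cdot,\tau)$ is entire, $\theta_z(0,\tau)\neq0$, and $\theta(a/p,\tau)\ne0$ for every integer $a$ not divisible by $p$. For such $a$ put $$s_a(\tau)=\frac1{2\pi i}\,\frac{\theta_z(a/p,\tau)}{\theta(a/p,\tau)},\qquad t_a(\tau)=\frac12(2\pi i)^{-2}\left(\frac{\theta_{zz}(a/p,\tau)}{\theta(a/p,\tau)}-\frac{\theta_{zzz}(0,\tau)}{3\,\theta_z(0,\tau)}\right).$$ Then $s_a$ and $t_a$ depend only on the class of $a$ in $(\mathbb Z/p\mathbb Z)^*$; each $t_a$ is a modular form of weight two for $\Gamma_1(p)$, with the absolutely convergent expansion $$t_a(\tau)=\frac1{12}-\sum_{d>0}q^d\sum_{k\mid d}\frac dk\left(\xi^{ak}+\xi^{-ak}\right);$$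 and for all $a,b,c\in(\mathbb Z/p\mathbb Z)^*$ with $a+b+c=0$ $$s_as_b+s_bs_c+s_cs_a+t_a+t_b+t_c=0 .$$ Moreover $t_{-a}=t_a$ for every $a\in(\mathbb Z/p\mathbb Z)^*$. -/

import Mathlib

open scoped UpperHalfPlane Real

noncomputable section

namespace ThetaForms

/-- The nome `q = exp (2 π i τ)`. -/
def q (τ : ℍ) : ℂ := Complex.exp (2 * π * Complex.I * (τ : ℂ))

/-- Jacobi's theta function with characteristic `(1, 1)`, by its product expansion
`θ(z, τ) = q^(1/8) (2 sin π z) ∏_{l ≥ 1} (1 - q^l)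
  ∏_{l ≥ 1} (1 - q^l e^{2 π i z}) (1 - q^l e^{-2 π i z})`, where `q^(1/8)` is `exp (2 π i τ / 8)`.
The products over `l ≥ 1` are indexed by `l + 1` with `l : ℕ`. -/
def theta (z : ℂ) (τ : ℍ) : ℂ :=
  Complex.exp (2 * π * Complex.I * (τ : ℂ) / 8) * (2 * Complex.sin (π * z)) *
    (∏' l : ℕ, (1 - q τ ^ (l + 1))) *
    ∏' l : ℕ, ((1 - q τ ^ (l + 1) * Complex.exp (2 * π * Complex.I * z)) *
      (1 - q τ ^ (l + 1) * Complex.exp (-(2 * π * Complex.I * z))))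

/-- `s_a(τ) = (2 π i)⁻¹ (d/dz) log θ(z, τ)` at `z = a / p`. -/
def s (p : ℕ) (a : ℤ) (τ : ℍ) : ℂ :=
  (2 * π * Complex.I)⁻¹ * logDeriv (fun z : ℂ => theta z τ) ((a : ℂ) / (p : ℂ))

/-- `t_a(τ) = (1/2) (2 π i)⁻² (θ_zz(a/p, τ) / θ(a/p, τ) - θ_zzz(0, τ) / (3 θ_z(0, τ)))`. -/
def t (p : ℕ) (a : ℤ) (τ : ℍ) : ℂ :=
  (1 / 2) * (2 * π * Complex.I) ^ (-2 : ℤ) *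
    (iteratedDeriv 2 (fun z : ℂ => theta z τ) ((a : ℂ) / (p : ℂ)) /
        theta ((a : ℂ) / (p : ℂ)) τ -
      iteratedDeriv 3 (fun z : ℂ => theta z τ) 0 /
        (3 * deriv (fun z : ℂ => theta z τ) 0))

/-- The root of unity `ξ = exp (2 π i / p)`. -/
def xi (p : ℕ) : ℂ := Complex.exp (2 * π * Complex.I / (p : ℂ))

/-- The `d`-th term `q^d ∑_{k ∣ d} (d / k) (ξ^{a k} + ξ^{-a k})` of the `q`-expansion of `t_a`. -/
def tTerm (p : ℕ) (a : ℤ) (τ : ℍ) (d : ℕ+) : ℂ :=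
  q τ ^ (d : ℕ) * ∑ k ∈ (d : ℕ).divisors,
    ((d : ℕ) : ℂ) / (k : ℂ) * (xi p ^ (a * (k : ℤ)) + xi p ^ (-(a * (k : ℤ))))

lemma summable_q (τ : ℍ) : Summable (fun l : ℕ => ‖q τ ^ (l + 1)‖) := by
  have h : ‖q τ‖ < 1 := by
    have := UpperHalfPlane.norm_exp_two_pi_I_lt_one τ
    simpa [q] using this
  simp only [norm_pow]
  exact (summable_nat_add_iff 1).2 (summable_geometric_of_lt_one (norm_nonneg _) h)

/-- Convergence of the first product in `theta`. -/
lemma multipliable_one_sub_q (τ : ℍ) : Multipliable (fun l : ℕ => 1 - q τ ^ (l + 1)) := by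
  simp only [sub_eq_add_neg]
  exact multipliable_one_add_of_summable (by simpa using summable_q τ)

/-- Convergence of each factor of the second product in `theta`. -/
lemma multipliable_one_sub_q_mul (τ : ℍ) (w : ℂ) :
    Multipliable (fun l : ℕ => 1 - q τ ^ (l + 1) * w) := by
  simp only [sub_eq_add_neg]
  exact multipliable_one_add_of_summable
    (by simpa only [norm_neg, norm_mul] using (summable_q τ).mul_right ‖w‖)

/-- Convergence of the second product in `theta`. -/
lemma multipliable_theta_product (τ : ℍ) (z : ℂ) :
    Multipliable (fun l : ℕ => (1 - q τ ^ (l + 1) * Complex.exp (2 * π * Complex.I * z)) *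
      (1 - q τ ^ (l + 1) * Complex.exp (-(2 * π * Complex.I * z)))) :=
  (multipliable_one_sub_q_mul τ _).mul (multipliable_one_sub_q_mul τ _)

end ThetaForms

end

noncomputable section

namespace ThetaForms

open Complex Filter Topology
open scoped ModularForm Manifold MatrixGroups

/-! For fixed τ, `theta` is an odd entire function of z with multiplier -1 for the period 1 and
-exp(-πiτ - 2πiz) for the period τ, and its zeros are simple and are exactly the lattice points.
Liouville's theorem then gives two rigidity principles that carry the whole proof: an entire
function with the same multipliers that vanishes at 0 is a constant multiple of `theta`
(`exists_eq_const_mul_theta`), and an elliptic function with only removable singularities is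
constant (`eq_of_periodic_compl_lattice`).

Modularity: exp(-πicz²/(cτ+d)) θ(z/(cτ+d), γτ) has the multipliers of θ(z, τ), hence is proportional
to it (`exists_theta_transform`). The Gaussian shifts θ''/θ at a/p and θ'''/(3θ') at 0 by the same
amount, so it drops out of t_a (`tFun_transform`).

Quadratic relation: cleared of denominators, it says that a certain function Φ of x vanishes. Φ has
the multipliers of θ(x)θ(x+y) and vanishes at 0 and at -y, so it is a constant times that product;
its derivative at 0 shows that the constant is 0 (`theta_three_term`).

Expansion: the product gives θ'/θ as a Lambert series. The candidate `tSeries` for t_a changes under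
z ↦ z+τ exactly as θ''/θ does, up to normalization, so the two differ by a constant, which is read
off at z = 0 (`iteratedDeriv_two_div_theta_eq`).

Cusps: the expansion gives |t_a| ≤ 5(1 + 1/Im τ)³. Each SL₂(ℤ)-translate is therefore p-periodic of
polynomial growth at infinity, and so bounded there. -/

/-! ### The theta product, its quasi-periods and its zeros. -/

lemma norm_q_lt_one (τ : ℍ) : ‖q τ‖ < 1 := by
  simpa [q] using UpperHalfPlane.norm_exp_two_pi_I_lt_one τ

lemma q_ne_zero (τ : ℍ) : q τ ≠ 0 := exp_ne_zero _

/-- The product `∏_{l ≥ 1} (1 - q^l w)`. -/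
def qProd (τ : ℍ) (w : ℂ) : ℂ := ∏' l : ℕ, (1 - q τ ^ (l + 1) * w)

/-- Source of the quasi-period τ: z ↦ z + τ multiplies exp(2πiz) by q, which shifts the index of the
product by one. -/
lemma qProd_eq_mul (τ : ℍ) (w : ℂ) : qProd τ w = (1 - q τ * w) * qProd τ (q τ * w) := by
  rw [qProd, tprod_eq_zero_mul']
  · simp only [qProd, zero_add, pow_one]
    congr 1
    exact tprod_congr fun l => by ring
  · refine (multipliable_one_sub_q_mul τ (q τ * w)).congr fun l => by ring

lemma qProd_ne_zero (τ : ℍ) {w : ℂ} (hw : ∀ l : ℕ, q τ ^ (l + 1) * w ≠ 1) : qProd τ w ≠ 0 := by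
  have := tprod_one_add_ne_zero_of_summable (f := fun l : ℕ => -(q τ ^ (l + 1) * w))
    (fun l => by rw [← sub_eq_add_neg]; exact sub_ne_zero.2 (hw l).symm)
    (by simpa only [norm_neg, norm_mul] using (summable_q τ).mul_right ‖w‖)
  simpa only [qProd, sub_eq_add_neg] using this

lemma differentiable_qProd (τ : ℍ) : Differentiable ℂ (qProd τ) := by
  intro w
  have hu : Summable fun l : ℕ => ‖q τ ^ (l + 1)‖ * (‖w‖ + 1) := (summable_q τ).mul_right _
  have h := (Summable.hasProdLocallyUniformlyOn_nat_one_add (K := Metric.ball w 1)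
    (f := fun (l : ℕ) (w : ℂ) => -(q τ ^ (l + 1) * w)) Metric.isOpen_ball hu
    (.of_forall fun l x hx => by
      rw [norm_neg, norm_mul]
      gcongr
      have h1 : ‖x - w‖ < 1 := by simpa [dist_eq_norm] using hx
      have h2 := norm_add_le w (x - w)
      rw [add_sub_cancel] at h2
      linarith) (fun l => by fun_prop))
  have h' := h.differentiableOn (.of_forall fun s => by
    simpa [Finset.prod_fn] using DifferentiableOn.finsetProd (fun _ _ => by fun_prop))
    Metric.isOpen_ball
  have h3 := h'.differentiableAt (Metric.isOpen_ball.mem_nhds (Metric.mem_ball_self one_pos))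
  simp only [← sub_eq_add_neg] at h3
  exact h3

/-- The constant factor `q^(1/8) ∏ (1 - q^l)` of `theta`. -/
def thetaConst (τ : ℍ) : ℂ := exp (2 * π * I * (τ : ℂ) / 8) * qProd τ 1

lemma thetaConst_ne_zero (τ : ℍ) : thetaConst τ ≠ 0 := by
  refine mul_ne_zero (exp_ne_zero _) (qProd_ne_zero τ fun l h => ?_)
  have h1 : ‖q τ ^ (l + 1)‖ < 1 := by
    rw [norm_pow]; exact pow_lt_one₀ (norm_nonneg _) (norm_q_lt_one τ) (by simp)
  rw [mul_one] at h
  simp [h] at h1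

/-- The second product in `theta`, as a function of `z`. -/
def thetaProd (τ : ℍ) (z : ℂ) : ℂ :=
  qProd τ (exp (2 * π * I * z)) * qProd τ (exp (-(2 * π * I * z)))

lemma theta_eq (z : ℂ) (τ : ℍ) :
    theta z τ = thetaConst τ * (2 * sin (π * z)) * thetaProd τ z := by
  rw [theta, thetaConst, thetaProd,
    (multipliable_one_sub_q_mul τ _).tprod_mul (multipliable_one_sub_q_mul τ _)]
  simp only [qProd, mul_one]
  ring

lemma differentiable_thetaProd (τ : ℍ) : Differentiable ℂ (thetaProd τ) := by
  have h := differentiable_qProd τ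
  unfold thetaProd
  fun_prop

lemma differentiable_theta (τ : ℍ) : Differentiable ℂ (fun z => theta z τ) := by
  have h := differentiable_thetaProd τ
  simp only [theta_eq]
  fun_prop

lemma thetaProd_neg (τ : ℍ) (z : ℂ) : thetaProd τ (-z) = thetaProd τ z := by
  simp [thetaProd, mul_comm]

lemma theta_neg (z : ℂ) (τ : ℍ) : theta (-z) τ = -theta z τ := by
  simp [theta_eq, thetaProd_neg]

lemma theta_zero (τ : ℍ) : theta 0 τ = 0 := by simp [theta_eq]

lemma theta_add_one (z : ℂ) (τ : ℍ) : theta (z + 1) τ = -theta z τ := by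
  have h1 : exp (2 * π * I * (z + 1)) = exp (2 * π * I * z) := by
    rw [mul_add, exp_add, mul_one, exp_two_pi_mul_I, mul_one]
  have h2 : sin (π * (z + 1)) = - sin (π * z) := by rw [mul_add, mul_one, sin_add_pi]
  simp only [theta_eq, thetaProd, exp_neg, h1, h2]
  ring

lemma theta_add_tau (z : ℂ) (τ : ℍ) :
    theta (z + τ) τ = -exp (-(π * I * τ) - 2 * π * I * z) * theta z τ := by
  -- In terms of e = exp(πiz) and r = exp(πiτ) the claim becomes a rational identity, once one
  -- factor is split off each product.
  set e := exp (π * I * z) with he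
  set r := exp (π * I * τ) with hr
  have he0 : e ≠ 0 := exp_ne_zero _
  have hr0 : r ≠ 0 := exp_ne_zero _
  have hq : q τ = r ^ 2 := by rw [q, hr, ← exp_nat_mul]; congr 1; push_cast; ring
  have hw : exp (2 * π * I * z) = e ^ 2 := by rw [he, ← exp_nat_mul]; congr 1; push_cast; ring
  have hw' : exp (2 * π * I * (z + τ)) = r ^ 2 * e ^ 2 := by
    rw [mul_add, exp_add, hw, ← hq, q, mul_comm]
  have hm : exp (-(π * I * τ) - 2 * π * I * z) = r⁻¹ * (e ^ 2)⁻¹ := by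
    rw [exp_sub, exp_neg, hw, div_eq_mul_inv]
  have hs : sin (π * z) = (e⁻¹ - e) * I / 2 := by
    rw [sin, he, ← exp_neg]; ring_nf
  have hs' : sin (π * (z + τ)) = ((e * r)⁻¹ - e * r) * I / 2 := by
    rw [sin, he, hr, ← exp_add, ← exp_neg]; ring_nf
  have p1 := qProd_eq_mul τ (e ^ 2)
  have p2 := qProd_eq_mul τ ((r ^ 2 * e ^ 2)⁻¹)
  have e2 : q τ * (r ^ 2 * e ^ 2)⁻¹ = (e ^ 2)⁻¹ := by rw [hq]; field_simp
  rw [e2] at p2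
  rw [theta_eq, theta_eq, thetaProd, thetaProd, exp_neg, exp_neg, hw, hw', hm, hs, hs', p2, p1, hq]
  field_simp
  ring

lemma theta_add_int (z : ℂ) (m : ℤ) (τ : ℍ) : theta (z + m) τ = (-1) ^ m * theta z τ := by
  induction m with
  | zero => simp
  | succ n ih =>
    rw [show z + ((n + 1 : ℤ) : ℂ) = (z + (n : ℤ)) + 1 by push_cast; ring, theta_add_one, ih,
      zpow_add_one₀ (by norm_num)]
    ring
  | pred n ih =>
    have h := theta_add_one (z + ((-n - 1 : ℤ) : ℂ)) τ
    rw [show z + ((-n - 1 : ℤ) : ℂ) + 1 = z + ((-n : ℤ) : ℂ) by push_cast; ring, ih] at h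
    rw [zpow_sub_one₀ (by norm_num)]
    linear_combination h

lemma theta_add_int_mul_tau (z : ℂ) (n : ℤ) (τ : ℍ) :
    theta (z + n * τ) τ = (-1) ^ n * exp (-(π * I * n ^ 2 * τ) - 2 * π * I * n * z) * theta z τ := by
  induction n with
  | zero => simp
  | succ n ih =>
    rw [show z + ((n + 1 : ℤ) : ℂ) * τ = (z + (n : ℤ) * τ) + τ by push_cast; ring, theta_add_tau, ih,
      zpow_add_one₀ (by norm_num),
      show (-(π * I * ((n + 1 : ℤ) : ℂ) ^ 2 * τ) - 2 * π * I * ((n + 1 : ℤ) : ℂ) * z : ℂ) =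
        (-(π * I * τ) - 2 * π * I * (z + (n : ℤ) * τ)) +
        (-(π * I * ((n : ℤ) : ℂ) ^ 2 * τ) - 2 * π * I * (n : ℤ) * z) by push_cast; ring, exp_add]
    ring
  | pred n ih =>
    have h := theta_add_tau (z + ((-n - 1 : ℤ) : ℂ) * τ) τ
    rw [show z + ((-n - 1 : ℤ) : ℂ) * τ + τ = z + ((-n : ℤ) : ℂ) * τ by push_cast; ring, ih,
      show (-(π * I * ((-n : ℤ) : ℂ) ^ 2 * τ) - 2 * π * I * ((-n : ℤ) : ℂ) * z : ℂ) =
        (-(π * I * τ) - 2 * π * I * (z + ((-n - 1 : ℤ) : ℂ) * τ)) +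
        (-(π * I * ((-n - 1 : ℤ) : ℂ) ^ 2 * τ) - 2 * π * I * ((-n - 1 : ℤ) : ℂ) * z) by
          push_cast; ring, exp_add] at h
    rw [zpow_sub_one₀ (by norm_num)]
    have h0 := exp_ne_zero (-(π * I * τ) - 2 * π * I * (z + ((-n - 1 : ℤ) : ℂ) * τ))
    apply mul_left_cancel₀ h0
    linear_combination h

/-- The lattice `ℤ + ℤ τ`. -/
def lattice (τ : ℍ) : Set ℂ := {z | ∃ m n : ℤ, z = m + n * τ}

lemma theta_add_lattice (z : ℂ) (m n : ℤ) (τ : ℍ) :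
    theta (z + (m + n * τ)) τ =
      (-1) ^ (m + n) * exp (-(π * I * n ^ 2 * τ) - 2 * π * I * n * z) * theta z τ := by
  have h : exp (-(π * I * n ^ 2 * τ) - 2 * π * I * n * (z + m)) =
      exp (-(π * I * n ^ 2 * τ) - 2 * π * I * n * z) := by
    rw [exp_eq_exp_iff_exists_int]
    exact ⟨-(n * m), by push_cast; ring⟩
  rw [← add_assoc, theta_add_int_mul_tau, theta_add_int, zpow_add₀ (by norm_num), h]
  ring

/-- The sine vanishes at the integers and the factors of the two products at the points m + nτ with
n ≠ 0; conversely the zero at 0 is carried to every lattice point by quasi-periodicity. -/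
lemma theta_eq_zero_iff {z : ℂ} {τ : ℍ} : theta z τ = 0 ↔ z ∈ lattice τ := by
  have key : ∀ (l : ℕ) (z : ℂ), q τ ^ (l + 1) * exp (2 * π * I * z) = 1 → z ∈ lattice τ := by
    intro l z h
    rw [q, ← exp_nat_mul, ← exp_add, exp_eq_one_iff] at h
    obtain ⟨n, hn⟩ := h
    refine ⟨n, -(l + 1), ?_⟩
    apply mul_left_cancel₀ two_pi_I_ne_zero
    push_cast at hn ⊢
    linear_combination hn
  constructor
  · intro h
    by_contra hz
    rw [theta_eq] at h
    refine (mul_ne_zero (mul_ne_zero (thetaConst_ne_zero τ) (mul_ne_zero two_ne_zero ?_)) ?_) h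
    · rw [Ne, sin_eq_zero_iff]
      rintro ⟨k, hk⟩
      refine hz ⟨k, 0, ?_⟩
      rw [mul_comm] at hk
      have := mul_right_cancel₀ (by exact_mod_cast Real.pi_ne_zero) hk
      simp [this]
    · refine mul_ne_zero (qProd_ne_zero τ fun l hl => hz (key l z hl)) (qProd_ne_zero τ fun l hl => ?_)
      rw [← mul_neg] at hl
      obtain ⟨m, n, h⟩ := key l _ hl
      exact hz ⟨-m, -n, by push_cast; linear_combination -h⟩
  · rintro ⟨m, n, rfl⟩
    rw [← zero_add ((m : ℂ) + n * τ), theta_add_lattice, theta_zero, mul_zero]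

lemma thetaProd_zero_ne_zero (τ : ℍ) : thetaProd τ 0 ≠ 0 := by
  have h : qProd τ 1 ≠ 0 := right_ne_zero_of_mul (thetaConst_ne_zero τ)
  simpa [thetaProd] using h

lemma deriv_theta_zero (τ : ℍ) :
    deriv (fun z => theta z τ) 0 = thetaConst τ * (2 * π) * thetaProd τ 0 := by
  have h1 : HasDerivAt (fun z : ℂ => sin (π * z)) π 0 := by
    have := ((hasDerivAt_id (0 : ℂ)).const_mul (π : ℂ)).csin
    simpa using this
  have h := ((h1.const_mul 2).const_mul (thetaConst τ)).mul
    (differentiable_thetaProd τ 0).hasDerivAt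
  rw [show (fun z => theta z τ) = _ from funext fun z => theta_eq z τ]
  rw [show deriv (fun z => thetaConst τ * (2 * sin (π * z)) * thetaProd τ z) 0 = _ from h.deriv]
  simp

lemma deriv_theta_zero_ne_zero (τ : ℍ) : deriv (fun z => theta z τ) 0 ≠ 0 := by
  rw [deriv_theta_zero]
  refine mul_ne_zero (mul_ne_zero (thetaConst_ne_zero τ) ?_) (thetaProd_zero_ne_zero τ)
  exact mul_ne_zero two_ne_zero (by exact_mod_cast Real.pi_ne_zero)

/-- Differentiate the quasi-periodicity at 0: since θ(0) = 0, the derivative of the multiplier does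
not contribute, and θ'(0) ≠ 0 is carried over. -/
lemma deriv_theta_ne_zero {z : ℂ} {τ : ℍ} (hz : theta z τ = 0) :
    deriv (fun z => theta z τ) z ≠ 0 := by
  obtain ⟨m, n, rfl⟩ := theta_eq_zero_iff.1 hz
  intro h
  have h1 : HasDerivAt (fun z => theta (z + (m + n * τ)) τ) 0 0 := by
    have := (differentiable_theta τ (0 + (m + n * τ))).hasDerivAt.comp_add_const
    rw [zero_add, h] at this
    exact this
  have h2 : HasDerivAt (fun z : ℂ => (-1 : ℂ) ^ (m + n) *
      exp (-(π * I * n ^ 2 * τ) - 2 * π * I * n * z)) _ 0 :=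
    (DifferentiableAt.hasDerivAt (by fun_prop))
  have h3 := h2.mul (differentiable_theta τ 0).hasDerivAt
  simp only [theta_add_lattice] at h1
  have h4 := h3.unique h1
  rw [theta_zero, mul_zero, zero_add] at h4
  refine mul_ne_zero (mul_ne_zero (zpow_ne_zero _ (by norm_num)) (exp_ne_zero _))
    (deriv_theta_zero_ne_zero τ) h4

/-! ### Liouville arguments. -/

/-- An entire function vanishing at the zeros of `g`, all simple, is divisible by `g`. -/
lemma exists_differentiable_mul_eq {g h : ℂ → ℂ} (hg : Differentiable ℂ g)
    (hh : Differentiable ℂ h) (hs : ∀ z, g z = 0 → deriv g z ≠ 0) (hz : ∀ z, g z = 0 → h z = 0) :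
    ∃ d : ℂ → ℂ, Differentiable ℂ d ∧ ∀ z, h z = g z * d z := by
  classical
  -- The value at a zero is the limit of the quotient; near a zero the quotient equals a quotient of
  -- difference slopes, which are differentiable there.
  refine ⟨fun z => if g z = 0 then deriv h z / deriv g z else h z / g z, fun z => ?_, fun z => ?_⟩
  · by_cases h0 : g z = 0
    · have hd : ∀ {f : ℂ → ℂ}, Differentiable ℂ f → DifferentiableAt ℂ (dslope f z) z := fun hf =>
        ((differentiableOn_dslope univ_mem).2 hf.differentiableOn).differentiableAt univ_mem
      have hne : dslope g z z ≠ 0 := by rw [dslope_same]; exact hs z h0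
      refine ((hd hh).div (hd hg) hne).congr_of_eventuallyEq ?_
      filter_upwards [(hd hg).continuousAt.eventually_ne hne] with w hw
      by_cases hwz : w = z
      · subst hwz; simp [h0]
      · have h1 : (w - z) * dslope g z w = g w := by
          simpa [h0] using sub_smul_dslope g z w
        have h2 : (w - z) * dslope h z w = h w := by
          simpa [hz z h0] using sub_smul_dslope h z w
        have h3 : w - z ≠ 0 := sub_ne_zero.2 hwz
        have h4 : g w ≠ 0 := h1 ▸ mul_ne_zero h3 hw
        simp only [h4, if_false, Pi.div_apply]
        rw [← h1, ← h2, mul_div_mul_left _ _ h3]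
    · refine ((hh z).div (hg z) h0).congr_of_eventuallyEq ?_
      filter_upwards [(hg z).continuousAt.eventually_ne h0] with w hw
      simp [hw]
  · by_cases h0 : g z = 0
    · simp [h0, hz z h0]
    · simp [h0]; field_simp

lemma eq_of_periodic {F : ℂ → ℂ} {τ : ℍ} (hF : Differentiable ℂ F) (h1 : ∀ z, F (z + 1) = F z)
    (h2 : ∀ z, F (z + τ) = F z) (z w : ℂ) : F z = F w := by
  refine hF.apply_eq_apply_of_bounded ?_ z w
  have hK : IsCompact ((fun x : ℝ × ℝ => F (x.1 + x.2 * τ)) '' (Set.Icc 0 1 ×ˢ Set.Icc 0 1)) := by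
    refine (isCompact_Icc.prod isCompact_Icc).image ?_
    have := hF.continuous
    fun_prop
  refine hK.isBounded.subset ?_
  rintro _ ⟨z, rfl⟩
  have hτ : (τ : ℂ).im ≠ 0 := τ.im_pos.ne'
  -- Real coordinates of z in the basis 1, τ; their fractional parts move z into the compact
  -- fundamental parallelogram.
  set y : ℝ := z.im / (τ : ℂ).im
  set x : ℝ := z.re - y * (τ : ℂ).re
  have hz : z = x + y * τ := by
    apply Complex.ext
    · simp [x]
    · simp [y]
      field_simp
  refine ⟨(Int.fract x, Int.fract y), ⟨⟨Int.fract_nonneg _, (Int.fract_lt_one _).le⟩,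
    ⟨Int.fract_nonneg _, (Int.fract_lt_one _).le⟩⟩, ?_⟩
  have p1 : Function.Periodic F 1 := h1
  have p2 : Function.Periodic F (τ : ℂ) := h2
  have e : z = ((Int.fract x : ℝ) : ℂ) + ((Int.fract y : ℝ) : ℂ) * τ +
      (⌊x⌋ : ℂ) * 1 + (⌊y⌋ : ℂ) * τ := by
    rw [hz]
    conv_lhs => rw [← Int.fract_add_floor x, ← Int.fract_add_floor y]
    push_cast
    ring
  have := p2.int_mul ⌊y⌋ (((Int.fract x : ℝ) : ℂ) + ((Int.fract y : ℝ) : ℂ) * τ + (⌊x⌋ : ℂ) * 1)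
  rw [← e, p1.int_mul ⌊x⌋] at this
  exact this.symm

lemma zero_mem_lattice (τ : ℍ) : (0 : ℂ) ∈ lattice τ := ⟨0, 0, by simp⟩

lemma add_mem_lattice_iff {z w : ℂ} {τ : ℍ} (hw : w ∈ lattice τ) :
    z + w ∈ lattice τ ↔ z ∈ lattice τ := by
  obtain ⟨m, n, rfl⟩ := hw
  constructor
  · rintro ⟨m', n', h⟩
    exact ⟨m' - m, n' - n, by push_cast; linear_combination h⟩
  · rintro ⟨m', n', h⟩
    exact ⟨m' + m, n' + n, by push_cast; linear_combination h⟩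

lemma one_mem_lattice (τ : ℍ) : (1 : ℂ) ∈ lattice τ := ⟨1, 0, by simp⟩

lemma tau_mem_lattice (τ : ℍ) : (τ : ℂ) ∈ lattice τ := ⟨0, 1, by simp⟩

lemma isOpen_compl_lattice (τ : ℍ) : IsOpen (lattice τ)ᶜ := by
  have h : (lattice τ)ᶜ = (fun z => theta z τ) ⁻¹' {0}ᶜ := by
    ext z; simp [theta_eq_zero_iff]
  rw [h]
  exact isOpen_compl_singleton.preimage (differentiable_theta τ).continuous

lemma dense_compl_lattice (τ : ℍ) : Dense (lattice τ)ᶜ := by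
  refine Set.Countable.dense_compl ℝ ?_
  have h : lattice τ = Set.range fun x : ℤ × ℤ => (x.1 : ℂ) + x.2 * τ := by
    ext z; simp [lattice, eq_comm]
  rw [h]
  exact Set.countable_range _

lemma eventually_notMem_lattice (τ : ℍ) : ∀ᶠ z in 𝓝[≠] (0 : ℂ), z ∉ lattice τ := by
  filter_upwards [(differentiable_theta τ 0).hasDerivAt.eventually_ne
    (deriv_theta_zero_ne_zero τ) (c := 0)] with z hz
  rwa [← theta_eq_zero_iff]

/-- Liouville's theorem for elliptic functions whose only possible singularities, at the lattice
points, are removable. -/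
lemma eq_of_periodic_compl_lattice {f g : ℂ → ℂ} {τ : ℍ}
    (hf : ∀ z, z ∉ lattice τ → DifferentiableAt ℂ f z)
    (h1 : ∀ z, z ∉ lattice τ → f (z + 1) = f z) (h2 : ∀ z, z ∉ lattice τ → f (z + τ) = f z)
    (hg : DifferentiableAt ℂ g 0) (hfg : f =ᶠ[𝓝[≠] 0] g) {z : ℂ} (hz : z ∉ lattice τ) :
    f z = g 0 := by
  classical
  set F : ℂ → ℂ := fun z => if z ∈ lattice τ then g 0 else f z with hF
  have F1 : Function.Periodic F 1 := by
    intro z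
    by_cases h : z ∈ lattice τ <;> simp [F, add_mem_lattice_iff (one_mem_lattice τ), h, h1]
  have F2 : Function.Periodic F (τ : ℂ) := by
    intro z
    by_cases h : z ∈ lattice τ <;> simp [F, add_mem_lattice_iff (tau_mem_lattice τ), h, h2]
  have F0 : DifferentiableAt ℂ F 0 := by
    refine hg.congr_of_eventuallyEq ?_
    have h : ∀ᶠ z in 𝓝[≠] (0 : ℂ), F z = g z := by
      filter_upwards [hfg, eventually_notMem_lattice τ] with z h3 h4
      simp [F, h4, h3]
    rw [eventually_nhdsWithin_iff] at h
    filter_upwards [h] with w hw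
    by_cases h0 : w = 0
    · simp [F, h0, zero_mem_lattice]
    · exact hw h0
  have Fd : Differentiable ℂ F := by
    intro w
    by_cases hw : w ∈ lattice τ
    · obtain ⟨m, n, rfl⟩ := hw
      have e : F = fun z => F (z - (m + n * τ)) := by
        funext z
        rw [← sub_sub, F2.sub_int_mul_eq, ← mul_one (m : ℂ), F1.sub_int_mul_eq]
      rw [e]
      refine DifferentiableAt.comp (𝕜 := ℂ) (g := F) _ ?_ (by fun_prop)
      simpa using F0
    · refine (hf w hw).congr_of_eventuallyEq ?_
      filter_upwards [(isOpen_compl_lattice τ).mem_nhds hw] with v hv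
      have hv' : v ∉ lattice τ := hv
      simp [F, hv']
  have := eq_of_periodic Fd F1 F2 z 0
  simpa [F, hz, zero_mem_lattice] using this

/-- Lets `theta` be cancelled even at its zeros, by continuity and density of the complement of the
lattice. -/
lemma eq_of_theta_mul_eq {A B : ℂ → ℂ} {τ : ℍ} (hA : Continuous A) (hB : Continuous B)
    (h : ∀ z, theta z τ * A z = theta z τ * B z) : A = B :=
  hA.ext_on (dense_compl_lattice τ) hB fun z hz =>
    mul_left_cancel₀ (fun h0 => hz (theta_eq_zero_iff.1 h0)) (h z)

/-- The zero set of a quasi-periodic function is invariant under translation by the lattice. -/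
lemma eq_zero_add_lattice {g : ℂ → ℂ} {τ : ℍ} (h1 : ∀ z, g (z + 1) = 0 ↔ g z = 0)
    (h2 : ∀ z, g (z + τ) = 0 ↔ g z = 0) (h0 : g 0 = 0) {z : ℂ} (hz : z ∈ lattice τ) :
    g z = 0 := by
  obtain ⟨m, n, rfl⟩ := hz
  have b1 : ∀ m : ℤ, g m = 0 := by
    intro m
    induction m with
    | zero => simpa using h0
    | succ n ih => rw [← h1] at ih; simpa using ih
    | pred n ih => rw [← h1]; simpa using ih
  induction n with
  | zero => simpa using b1 m
  | succ n ih =>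
    rw [← h2] at ih
    rw [← ih]; congr 1; push_cast; ring
  | pred n ih =>
    rw [← h2, ← ih]; congr 1; push_cast; ring

/-- `theta` is determined up to a constant factor by its quasi-periods and its zero at `0`. -/
lemma exists_eq_const_mul_theta {g : ℂ → ℂ} {τ : ℍ} (hg : Differentiable ℂ g) (h0 : g 0 = 0)
    (h1 : ∀ z, g (z + 1) = -g z)
    (h2 : ∀ z, g (z + τ) = -exp (-(π * I * τ) - 2 * π * I * z) * g z) :
    ∃ C : ℂ, ∀ z, g z = C * theta z τ := by
  obtain ⟨d, hd, e⟩ := exists_differentiable_mul_eq (differentiable_theta τ) hg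
    (fun z => deriv_theta_ne_zero) (fun z h =>
      eq_zero_add_lattice (fun z => by rw [h1, neg_eq_zero])
        (fun z => by rw [h2]; simp [exp_ne_zero]) h0 (theta_eq_zero_iff.1 h))
  have d1 : (fun z => d (z + 1)) = d := by
    refine eq_of_theta_mul_eq (τ := τ) (by have := hd.continuous; fun_prop) hd.continuous fun z => ?_
    have := e (z + 1)
    rw [h1, theta_add_one, e] at this
    linear_combination this
  have d2 : (fun z => d (z + τ)) = d := by
    refine eq_of_theta_mul_eq (τ := τ) (by have := hd.continuous; fun_prop) hd.continuous fun z => ?_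
    have := e (z + τ)
    rw [h2, theta_add_tau, e] at this
    refine mul_left_cancel₀ (exp_ne_zero (-(π * I * τ) - 2 * π * I * z)) ?_
    linear_combination this
  exact ⟨d 0, fun z => by
    rw [e, eq_of_periodic hd (congrFun d1) (congrFun d2) z 0, mul_comm]⟩

/-! ### Modular transformation of theta and of t_a. -/

lemma exp_neg_pi_mul_I_mul_int (n : ℤ) : exp (-(π * I * n)) = (-1) ^ n := by
  rw [show -(π * I * n : ℂ) = (-n : ℤ) * (π * I) by push_cast; ring, exp_int_mul, exp_pi_mul_I,
    zpow_neg, ← inv_zpow]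
  norm_num

/-- The transformation of `theta` under a modular substitution, up to a constant factor. -/
lemma exists_theta_transform {τ τ' : ℍ} {a b c d : ℤ} (hdet : a * d - b * c = 1)
    (hj : (c * τ + d : ℂ) ≠ 0) (h : (τ' : ℂ) * (c * τ + d) = a * τ + b) :
    ∃ C : ℂ, C ≠ 0 ∧ ∀ z, theta (z / (c * τ + d)) τ' =
      C * exp (π * I * c * z ^ 2 / (c * τ + d)) * theta z τ := by
  set j : ℂ := c * τ + d with hjdef
  have hdet' : (a * d - b * c : ℂ) = 1 := by exact_mod_cast hdet
  -- Division by j sends the periods 1 and τ into the lattice of τ'; this is the inverse matrix,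
  -- hence the use of the determinant.
  have e1 : 1 / j = a - c * τ' := by
    rw [div_eq_iff hj]; linear_combination -hdet' + c * h - a * hjdef
  have e2 : τ / j = d * τ' - b := by
    rw [div_eq_iff hj]; linear_combination -τ * hdet' - d * h + b * hjdef
  -- Since ad - bc is odd, a and c are not both even, so a + c + ac is odd, and likewise for b and
  -- d. This makes both signs equal to -1.
  have hodd : ¬ Even (a * d - b * c) := by rw [hdet]; decide
  obtain ⟨C, hC⟩ := exists_eq_const_mul_theta (τ := τ)
    (g := fun z => exp (-(π * I * c * z ^ 2 / j)) * theta (z / j) τ')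
    (by have := differentiable_theta τ'; fun_prop) (by simp [theta_zero])
    (fun z => by
      have hs : (-1 : ℂ) ^ (a + -c + c * a) = -1 := by
        refine Odd.neg_one_zpow ?_
        rw [← Int.not_even_iff_odd]
        simp only [Int.even_sub, Int.even_mul, Int.even_add, even_neg] at hodd ⊢
        tauto
      rw [zpow_add₀ (by norm_num), ← exp_neg_pi_mul_I_mul_int (c * a)] at hs
      have hz : (z + 1) / j = z / j + (a + ((-c : ℤ) : ℂ) * τ') := by
        push_cast; rw [add_div, e1]; ring
      have he : exp (-(π * I * c * (z + 1) ^ 2 / j)) *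
          exp (-(π * I * ((-c : ℤ) : ℂ) ^ 2 * τ') - 2 * π * I * ((-c : ℤ) : ℂ) * (z / j)) =
          exp (-(π * I * ((c * a : ℤ) : ℂ))) * exp (-(π * I * c * z ^ 2 / j)) := by
        rw [← exp_add, ← exp_add]
        congr 1
        push_cast
        linear_combination -π * I * c * e1
      rw [hz, theta_add_lattice]
      linear_combination ((-1) ^ (a + -c) * theta (z / j) τ') * he +
        exp (-(π * I * c * z ^ 2 / j)) * theta (z / j) τ' * hs)
    (fun z => by
      have hs : (-1 : ℂ) ^ (-b + d + b * d) = -1 := by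
        refine Odd.neg_one_zpow ?_
        rw [← Int.not_even_iff_odd]
        simp only [Int.even_sub, Int.even_mul, Int.even_add, even_neg] at hodd ⊢
        tauto
      rw [zpow_add₀ (by norm_num), ← exp_neg_pi_mul_I_mul_int (b * d)] at hs
      have hz : (z + τ) / j = z / j + (((-b : ℤ) : ℂ) + d * τ') := by
        push_cast; rw [add_div, e2]; ring
      have e3 : (c * τ + d : ℂ) / j = 1 := by rw [← hjdef, div_self hj]
      have he : exp (-(π * I * c * (z + τ) ^ 2 / j)) *
          exp (-(π * I * d ^ 2 * τ') - 2 * π * I * d * (z / j)) =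
          exp (-(π * I * τ) - 2 * π * I * z) *
          (exp (-(π * I * ((b * d : ℤ) : ℂ))) * exp (-(π * I * c * z ^ 2 / j))) := by
        rw [← exp_add, ← exp_add, ← exp_add]
        congr 1
        push_cast
        linear_combination (-2 * π * I * z) * e3 - π * I * c * τ * e2 - π * I * d * h +
          π * I * d * τ' * hjdef - π * I * τ * hdet'
      rw [hz, theta_add_lattice]
      linear_combination ((-1) ^ (-b + d) * theta (z / j) τ') * he +
        exp (-(π * I * τ) - 2 * π * I * z) * exp (-(π * I * c * z ^ 2 / j)) *
          theta (z / j) τ' * hs)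
  have hC' : ∀ z, theta (z / j) τ' = C * exp (π * I * c * z ^ 2 / j) * theta z τ := fun z => by
    have h1 := hC z
    rw [exp_neg, inv_mul_eq_iff_eq_mul₀ (exp_ne_zero _)] at h1
    rw [h1]; ring
  refine ⟨C, ?_, hC'⟩
  rintro rfl
  refine deriv_theta_zero_ne_zero τ' ?_
  have : (fun z => theta z τ') = fun _ => 0 := by
    funext z
    simpa [hj] using hC' (z * j)
  rw [this, deriv_const]

/-- The function of `z` whose values at the points `a / p` are the `t_a`. -/
def tFun (z : ℂ) (τ : ℍ) : ℂ :=
  (1 / 2) * (2 * π * I) ^ (-2 : ℤ) *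
    (iteratedDeriv 2 (fun z : ℂ => theta z τ) z / theta z τ -
      iteratedDeriv 3 (fun z : ℂ => theta z τ) 0 / (3 * deriv (fun z : ℂ => theta z τ) 0))

lemma t_eq_tFun (p : ℕ) (a : ℤ) (τ : ℍ) : t p a τ = tFun (a / p) τ := rfl

lemma tFun_add_int (z : ℂ) (m : ℤ) (τ : ℍ) : tFun (z + m) τ = tFun z τ := by
  have h : iteratedDeriv 2 (fun z => theta z τ) (z + m) =
      (-1) ^ m * iteratedDeriv 2 (fun z => theta z τ) z := by
    have h1 := congrFun (iteratedDeriv_comp_add_const 2 (fun z => theta z τ) (m : ℂ)) z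
    simp only [theta_add_int] at h1
    rw [← h1, iteratedDeriv_const_mul _ (differentiable_theta τ).contDiff.contDiffAt]
  have hm : ((-1 : ℂ) ^ m) ≠ 0 := zpow_ne_zero _ (by norm_num)
  rw [tFun, tFun, h, theta_add_int, mul_div_mul_left _ _ hm]

lemma iteratedDeriv_two_theta_neg (z : ℂ) (τ : ℍ) :
    iteratedDeriv 2 (fun z => theta z τ) (-z) = -iteratedDeriv 2 (fun z => theta z τ) z := by
  have h1 := iteratedDeriv_comp_neg 2 (fun z => theta z τ) z
  simp only [theta_neg] at h1
  rw [iteratedDeriv_fun_neg] at h1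
  simpa using h1.symm

lemma tFun_neg (z : ℂ) (τ : ℍ) : tFun (-z) τ = tFun z τ := by
  rw [tFun, tFun, iteratedDeriv_two_theta_neg, theta_neg, neg_div_neg_eq]

/-- The effect of a Gaussian factor on the first three derivatives at `0`. -/
lemma deriv_exp_sq_mul {F : ℂ → ℂ} (hF : Differentiable ℂ F) (β : ℂ) :
    deriv (fun z => exp (β * z ^ 2) * F z) 0 = deriv F 0 ∧
    iteratedDeriv 2 (fun z => exp (β * z ^ 2) * F z) 0 = iteratedDeriv 2 F 0 + 2 * β * F 0 ∧
    iteratedDeriv 3 (fun z => exp (β * z ^ 2) * F z) 0 =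
      iteratedDeriv 3 F 0 + 6 * β * deriv F 0 := by
  -- The derivative is again a Gaussian times an entire function, so this rule can be iterated.
  have step : ∀ {G : ℂ → ℂ}, Differentiable ℂ G →
      deriv (fun z => exp (β * z ^ 2) * G z) =
        fun z => exp (β * z ^ 2) * (deriv G z + 2 * β * z * G z) := by
    intro G hG
    funext z
    have h1 : HasDerivAt (fun z : ℂ => exp (β * z ^ 2)) (exp (β * z ^ 2) * (β * (2 * z))) z := by
      simpa using ((hasDerivAt_pow 2 z).const_mul β).cexp
    rw [show deriv (fun z => exp (β * z ^ 2) * G z) z = _ from (h1.mul (hG z).hasDerivAt).deriv]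
    ring
  have hlin : ∀ {G : ℂ → ℂ}, Differentiable ℂ G →
      deriv (fun z => 2 * β * z * G z) = fun z => 2 * β * G z + 2 * β * z * deriv G z := by
    intro G hG
    funext z
    have h1 : HasDerivAt (fun z : ℂ => 2 * β * z) (2 * β) z := by
      simpa using (hasDerivAt_id z).const_mul (2 * β)
    exact (h1.mul (hG z).hasDerivAt).deriv
  have s1 := step hF
  have d1 : Differentiable ℂ fun z => deriv F z + 2 * β * z * F z := by
    have := hF.deriv; fun_prop
  have s2 := step d1
  have e2 : deriv (fun z => deriv F z + 2 * β * z * F z) =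
      fun z => deriv (deriv F) z + (2 * β * F z + 2 * β * z * deriv F z) := by
    funext z
    have h1 : HasDerivAt (fun z => 2 * β * z * F z) (2 * β * F z + 2 * β * z * deriv F z) z := by
      rw [← congrFun (hlin hF) z]
      exact DifferentiableAt.hasDerivAt (by fun_prop)
    exact ((hF.deriv z).hasDerivAt.add h1).deriv
  refine ⟨by simp [s1], ?_, ?_⟩
  · simp only [iteratedDeriv_succ, iteratedDeriv_zero, s1, s2, e2]
    simp
  · simp only [iteratedDeriv_succ, iteratedDeriv_zero, s1, s2, e2]
    have d2 : Differentiable ℂ fun z => deriv (deriv F) z + (2 * β * F z + 2 * β * z * deriv F z) +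
        2 * β * z * (deriv F z + 2 * β * z * F z) := by
      have := hF.deriv; have := hF.deriv.deriv; fun_prop
    rw [step d2]
    have h1 := (hF.deriv.deriv 0).hasDerivAt
    have h2 := ((hF 0).hasDerivAt.const_mul (2 * β))
    have h3 : HasDerivAt (fun z : ℂ => 2 * β * z) (2 * β) 0 := by
      simpa using (hasDerivAt_id (0 : ℂ)).const_mul (2 * β)
    have h4 := h3.mul (hF.deriv 0).hasDerivAt
    have h5 := h3.mul (d1 0).hasDerivAt
    have h6 := ((h1.add (h2.add h4)).add h5).deriv
    simp only [Pi.add_def, Pi.mul_def] at h6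
    beta_reduce
    rw [h6]
    simp
    ring

/-- The Gaussian adds 2β to θ''/θ at v and 6β to θ'''/θ' at 0. The factor 1/3 in `tFun` makes these
cancel, the constants C and D drop out of the quotients, and rescaling z by j leaves j². -/
lemma tFun_transform {τ τ' : ℍ} {j u v β C D : ℂ} (hj : j ≠ 0) (hC : C ≠ 0) (hD : D ≠ 0)
    (hv : v ∉ lattice τ)
    (h0 : ∀ z, theta (z / j) τ' = C * exp (β * z ^ 2) * theta z τ)
    (h1 : ∀ z, theta (z / j + u) τ' = D * exp (β * z ^ 2) * theta (z + v) τ) :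
    tFun u τ' = j ^ 2 * tFun v τ := by
  have dθ := differentiable_theta τ
  have dθ' := differentiable_theta τ'
  have dv : Differentiable ℂ (fun z => theta (z + v) τ) := by fun_prop
  have du : Differentiable ℂ (fun z => theta (z + u) τ') := by fun_prop
  obtain ⟨a1, -, a3⟩ := deriv_exp_sq_mul dθ β
  obtain ⟨-, b2, -⟩ := deriv_exp_sq_mul dv β
  have h0' : (fun z => theta (j⁻¹ * z) τ') = fun z => C * (exp (β * z ^ 2) * theta z τ) := by
    funext z; rw [← mul_assoc, ← h0, div_eq_inv_mul]
  have h1' : (fun z => theta (j⁻¹ * z + u) τ') =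
      fun z => D * (exp (β * z ^ 2) * theta (z + v) τ) := by
    funext z; rw [← mul_assoc, ← h1, div_eq_inv_mul]
  have c0 : ∀ n : ℕ, (j⁻¹) ^ n * iteratedDeriv n (fun z => theta z τ') 0 =
      C * iteratedDeriv n (fun z => exp (β * z ^ 2) * theta z τ) 0 := by
    intro n
    have e := congrFun (iteratedDeriv_comp_const_mul (n := n) dθ'.contDiff j⁻¹) 0
    rw [h0', iteratedDeriv_const_mul _ (Differentiable.contDiff (by fun_prop)).contDiffAt,
      mul_zero] at e
    exact e.symm
  have c1 : (j⁻¹) ^ 2 * iteratedDeriv 2 (fun z => theta z τ') u =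
      D * (iteratedDeriv 2 (fun z => theta z τ) v + 2 * β * theta v τ) := by
    have e := congrFun (iteratedDeriv_comp_const_mul (n := 2) du.contDiff j⁻¹) 0
    rw [h1', iteratedDeriv_const_mul _ (Differentiable.contDiff (by fun_prop)).contDiffAt,
      b2, mul_zero, congrFun (iteratedDeriv_comp_add_const 2 (fun z => theta z τ) v) 0,
      congrFun (iteratedDeriv_comp_add_const 2 (fun z => theta z τ') u) 0] at e
    simpa using e.symm
  have c2 : theta u τ' = D * theta v τ := by simpa using h1 0
  have k1 := c0 1
  have k3 := c0 3
  rw [iteratedDeriv_one, iteratedDeriv_one, a1] at k1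
  rw [a3] at k3
  have n0 : theta v τ ≠ 0 := fun h => hv (theta_eq_zero_iff.1 h)
  have n1 := deriv_theta_zero_ne_zero τ
  have g1 : deriv (fun z => theta z τ') 0 = j * (C * deriv (fun z => theta z τ) 0) := by
    rw [← k1]; field_simp
  have g3 : iteratedDeriv 3 (fun z => theta z τ') 0 = j ^ 3 * (C * (iteratedDeriv 3
      (fun z => theta z τ) 0 + 6 * β * deriv (fun z => theta z τ) 0)) := by
    rw [← k3]; field_simp
  have g2 : iteratedDeriv 2 (fun z => theta z τ') u = j ^ 2 * (D * (iteratedDeriv 2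
      (fun z => theta z τ) v + 2 * β * theta v τ)) := by
    rw [← c1]; field_simp
  rw [tFun, tFun, g1, g2, g3, c2]
  field_simp
  ring

lemma div_mem_lattice_iff {p : ℕ} (hp : p ≠ 0) {a : ℤ} {τ : ℍ} :
    (a / p : ℂ) ∈ lattice τ ↔ (p : ℤ) ∣ a := by
  have hp' : (p : ℂ) ≠ 0 := by exact_mod_cast hp
  constructor
  · rintro ⟨m, n, h⟩
    have hn : n = 0 := by
      have := congrArg Complex.im h
      rw [show (a / p : ℂ) = ((a / p : ℝ) : ℂ) by push_cast; rfl, ofReal_im] at this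
      simpa [τ.im_ne_zero] using this.symm
    rw [div_eq_iff hp', hn] at h
    refine ⟨m, ?_⟩
    have : (a : ℂ) = ((p * m : ℤ) : ℂ) := by rw [h]; push_cast; ring
    exact_mod_cast this
  · rintro ⟨m, rfl⟩
    refine ⟨m, 0, ?_⟩
    push_cast
    field_simp
    simp

/-- With c = pc' and d = 1 + pd', the point (a/p)(cτ+d) equals a/p + ad' + ac'τ, so it is a/p modulo
the lattice. This is where Γ₁(p) enters. -/
lemma t_smul {p : ℕ} (hp : p ≠ 0) {a : ℤ} (ha : ¬ (p : ℤ) ∣ a)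
    {γ : Matrix.SpecialLinearGroup (Fin 2) ℤ} (hγ : γ ∈ CongruenceSubgroup.Gamma1 p) (τ : ℍ) :
    t p a (γ • τ) = (γ 1 0 * τ + γ 1 1) ^ 2 * t p a τ := by
  have hp' : (p : ℂ) ≠ 0 := by exact_mod_cast hp
  obtain ⟨-, h11, h10⟩ := (CongruenceSubgroup.Gamma1_mem p γ).1 hγ
  obtain ⟨c', hc⟩ := (ZMod.intCast_zmod_eq_zero_iff_dvd _ _).1 h10
  obtain ⟨d', hd⟩ : (p : ℤ) ∣ γ 1 1 - 1 := by
    rw [← ZMod.intCast_zmod_eq_zero_iff_dvd]; push_cast; simp [h11]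
  have hj : (γ 1 0 * τ + γ 1 1 : ℂ) ≠ 0 := by
    simpa [UpperHalfPlane.denom] using UpperHalfPlane.denom_ne_zero
      (Matrix.SpecialLinearGroup.toGL (Matrix.SpecialLinearGroup.map (Int.castRingHom ℝ) γ)) τ
  have hdet : γ 0 0 * γ 1 1 - γ 0 1 * γ 1 0 = 1 := by
    have := γ.det_coe
    rwa [Matrix.det_fin_two] at this
  have hτ : ((γ • τ : ℍ) : ℂ) * (γ 1 0 * τ + γ 1 1) = γ 0 0 * τ + γ 0 1 := by
    rw [UpperHalfPlane.coe_specialLinearGroup_apply]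
    simp only [algebraMap_int_eq, eq_intCast, ofReal_intCast]
    exact div_mul_cancel₀ _ hj
  obtain ⟨C, hC, h⟩ := exists_theta_transform hdet hj hτ
  set j : ℂ := γ 1 0 * τ + γ 1 1 with hjdef
  have hc' : ((γ 1 0 : ℤ) : ℂ) = p * c' := by exact_mod_cast hc
  have hd' : ((γ 1 1 : ℤ) : ℂ) = 1 + p * d' := by
    have : γ 1 1 = 1 + p * d' := by linarith
    exact_mod_cast this
  have hv : (a / p : ℂ) * j = a / p + (((a * d' : ℤ) : ℂ) + ((a * c' : ℤ) : ℂ) * τ) := by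
    rw [hjdef, hc', hd']; push_cast; field_simp; ring
  rw [t_eq_tFun, t_eq_tFun]
  refine tFun_transform (β := π * I * γ 1 0 / j) hj hC
    (D := C * exp (π * I * γ 1 0 * (a / p) ^ 2 * j) * ((-1) ^ (a * d' + a * c') *
      exp (-(π * I * ((a * c' : ℤ) : ℂ) ^ 2 * τ) - 2 * π * I * ((a * c' : ℤ) : ℂ) * (a / p))))
    ?_ ((div_mem_lattice_iff hp).not.2 ha) (fun z => ?_) (fun z => ?_)
  · exact mul_ne_zero (mul_ne_zero hC (exp_ne_zero _))
      (mul_ne_zero (zpow_ne_zero _ (by norm_num)) (exp_ne_zero _))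
  · rw [h]; congr 3; ring
  · have hz : z / j + a / p = (z + (a / p : ℂ) * j) / j := by field_simp
    -- The terms of the exponent linear in z cancel because c·a/p = ac'; only the Gaussian and a
    -- constant remain, as `tFun_transform` requires.
    have he : exp (π * I * γ 1 0 * (z + (a / p : ℂ) * j) ^ 2 / j) *
        exp (-(π * I * ((a * c' : ℤ) : ℂ) ^ 2 * τ) -
          2 * π * I * ((a * c' : ℤ) : ℂ) * (z + a / p)) =
        exp (π * I * γ 1 0 * (a / p) ^ 2 * j) * exp (π * I * γ 1 0 / j * z ^ 2) *
        exp (-(π * I * ((a * c' : ℤ) : ℂ) ^ 2 * τ) -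
          2 * π * I * ((a * c' : ℤ) : ℂ) * (a / p)) := by
      rw [← exp_add, ← exp_add, ← exp_add]
      congr 1
      rw [hc']
      push_cast
      field_simp
      ring
    have ht : theta (z + (a / p : ℂ) * j) τ = (-1) ^ (a * d' + a * c') *
        exp (-(π * I * ((a * c' : ℤ) : ℂ) ^ 2 * τ) -
          2 * π * I * ((a * c' : ℤ) : ℂ) * (z + a / p)) * theta (z + a / p) τ := by
      rw [hv, ← add_assoc, theta_add_lattice]
    rw [hz, h, ht]
    linear_combination C * (-1) ^ (a * d' + a * c') * theta (z + a / p) τ * he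

/-! ### The three-term relation. -/

lemma deriv_theta_neg (z : ℂ) (τ : ℍ) :
    deriv (fun z => theta z τ) (-z) = deriv (fun z => theta z τ) z := by
  have h := deriv_comp_neg (fun z => theta z τ) z
  simp only [theta_neg] at h
  rw [deriv.fun_neg] at h
  linear_combination h

lemma iteratedDeriv_two_theta_zero (τ : ℍ) : iteratedDeriv 2 (fun z => theta z τ) 0 = 0 := by
  have h := iteratedDeriv_two_theta_neg 0 τ
  rw [neg_zero] at h
  linear_combination h / 2

lemma deriv_theta_add_one (z : ℂ) (τ : ℍ) :
    deriv (fun z => theta z τ) (z + 1) = -deriv (fun z => theta z τ) z := by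
  have h := deriv_comp_add_const (fun z => theta z τ) 1 z
  simp only [theta_add_one] at h
  rw [deriv.fun_neg] at h
  exact h.symm

lemma iteratedDeriv_two_theta_add_one (z : ℂ) (τ : ℍ) :
    iteratedDeriv 2 (fun z => theta z τ) (z + 1) = -iteratedDeriv 2 (fun z => theta z τ) z := by
  have h := congrFun (iteratedDeriv_comp_add_const 2 (fun z => theta z τ) 1) z
  simp only [theta_add_one] at h
  rw [iteratedDeriv_fun_neg] at h
  exact h.symm

/-- The multiplier of `theta` for the period `τ`. -/
def multiplier (τ : ℍ) (z : ℂ) : ℂ := -exp (-(π * I * τ) - 2 * π * I * z)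

lemma multiplier_ne_zero (τ : ℍ) (z : ℂ) : multiplier τ z ≠ 0 := neg_ne_zero.2 (exp_ne_zero _)

lemma hasDerivAt_multiplier (τ : ℍ) (z : ℂ) :
    HasDerivAt (multiplier τ) (-(2 * π * I) * multiplier τ z) z := by
  have h : HasDerivAt (fun z : ℂ => -(π * I * τ) - 2 * π * I * z) (-(2 * π * I)) z := by
    simpa using ((hasDerivAt_id z).const_mul (2 * π * I)).const_sub (-(π * I * τ))
  have h2 : HasDerivAt (multiplier τ) _ z := h.cexp.neg
  convert h2 using 1
  rw [multiplier]; ring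

lemma deriv_theta_add_tau (z : ℂ) (τ : ℍ) :
    deriv (fun z => theta z τ) (z + τ) = multiplier τ z *
      (deriv (fun z => theta z τ) z - 2 * π * I * theta z τ) := by
  have h := deriv_comp_add_const (fun z => theta z τ) τ z
  simp only [theta_add_tau] at h
  have h2 := ((hasDerivAt_multiplier τ z).mul (differentiable_theta τ z).hasDerivAt).deriv
  rw [← h]
  refine Eq.trans ?_ (h2.trans ?_)
  · rfl
  · ring

lemma iteratedDeriv_two_theta_add_tau (z : ℂ) (τ : ℍ) :
    iteratedDeriv 2 (fun z => theta z τ) (z + τ) = multiplier τ z *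
      (iteratedDeriv 2 (fun z => theta z τ) z - 2 * (2 * π * I) * deriv (fun z => theta z τ) z +
        (2 * π * I) ^ 2 * theta z τ) := by
  simp only [iteratedDeriv_succ, iteratedDeriv_zero]
  have h := deriv_comp_add_const (deriv fun z => theta z τ) τ z
  simp only [deriv_theta_add_tau] at h
  have h2 := ((hasDerivAt_multiplier τ z).mul (((differentiable_theta τ).deriv z).hasDerivAt.sub
    ((differentiable_theta τ z).hasDerivAt.const_mul (2 * π * I)))).deriv
  rw [← h]
  refine Eq.trans ?_ (h2.trans ?_)
  · rfl
  · simp only [Pi.sub_apply]; ring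

/-- The three-term relation `L(x) L(y) - L(x + y) (L(x) + L(y)) + ...` for the logarithmic
derivative `L` of `theta`, with denominators cleared. -/
lemma theta_three_term {y : ℂ} {τ : ℍ} (hy : y ∉ lattice τ) (x : ℂ) :
    2 * deriv (fun z => theta z τ) x * theta (x + y) τ * deriv (fun z => theta z τ) y -
      2 * deriv (fun z => theta z τ) (x + y) *
        (deriv (fun z => theta z τ) x * theta y τ + theta x τ * deriv (fun z => theta z τ) y) +
      iteratedDeriv 2 (fun z => theta z τ) x * theta (x + y) τ * theta y τ +
      theta x τ * iteratedDeriv 2 (fun z => theta z τ) y * theta (x + y) τ +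
      theta x τ * theta y τ * iteratedDeriv 2 (fun z => theta z τ) (x + y) -
      iteratedDeriv 3 (fun z => theta z τ) 0 / deriv (fun z => theta z τ) 0 *
        (theta x τ * theta y τ * theta (x + y) τ) = 0 := by
  have n1 := deriv_theta_zero_ne_zero τ
  have n0 : theta y τ ≠ 0 := fun h => hy (theta_eq_zero_iff.1 h)
  have z2 := iteratedDeriv_two_theta_zero τ
  have dθ := differentiable_theta τ
  have H1 : ∀ z, HasDerivAt (fun z => theta z τ) (deriv (fun z => theta z τ) z) z :=
    fun z => (dθ z).hasDerivAt
  have H2 : ∀ z, HasDerivAt (deriv fun z => theta z τ)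
      (iteratedDeriv 2 (fun z => theta z τ) z) z := fun z => by
    simpa only [iteratedDeriv_succ, iteratedDeriv_zero] using (dθ.deriv z).hasDerivAt
  have H3 : ∀ z, HasDerivAt (iteratedDeriv 2 fun z => theta z τ)
      (iteratedDeriv 3 (fun z => theta z τ) z) z := fun z => by
    simpa only [iteratedDeriv_succ, iteratedDeriv_zero] using (dθ.deriv.deriv z).hasDerivAt
  set T : ℂ → ℂ := fun z => theta z τ with hT
  set D := deriv T with hD
  set E := iteratedDeriv 2 T with hE
  set lam := iteratedDeriv 3 T 0 / D 0 with hlam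
  have hl : iteratedDeriv 3 T 0 = lam * D 0 := by rw [hlam]; field_simp
  -- The left-hand side as a function of x alone, with y fixed off the lattice.
  set Φ : ℂ → ℂ := fun x => 2 * D x * T (x + y) * D y -
      2 * D (x + y) * (D x * T y + T x * D y) + E x * T (x + y) * T y +
      T x * E y * T (x + y) + T x * T y * E (x + y) - lam * (T x * T y * T (x + y)) with hΦ
  change Φ x = 0
  have dD : Differentiable ℂ D := fun z => (H2 z).differentiableAt
  have dE : Differentiable ℂ E := fun z => (H3 z).differentiableAt
  have dΦ : Differentiable ℂ Φ := by fun_prop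
  have tT1 : ∀ z, T (z + 1) = -T z := fun z => theta_add_one z τ
  have tD1 : ∀ z, D (z + 1) = -D z := fun z => deriv_theta_add_one z τ
  have tE1 : ∀ z, E (z + 1) = -E z := fun z => iteratedDeriv_two_theta_add_one z τ
  have tT : ∀ z, T (z + τ) = multiplier τ z * T z := fun z => theta_add_tau z τ
  have tD : ∀ z, D (z + τ) = multiplier τ z * (D z - 2 * π * I * T z) :=
    fun z => deriv_theta_add_tau z τ
  have tE : ∀ z, E (z + τ) = multiplier τ z * (E z - 2 * (2 * π * I) * D z +
      (2 * π * I) ^ 2 * T z) := fun z => iteratedDeriv_two_theta_add_tau z τ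
  have p1 : ∀ z, Φ (z + 1) = Φ z := by
    intro z
    simp only [hΦ, add_right_comm z 1 y, tT1, tD1, tE1]
    ring
  have p2 : ∀ z, Φ (z + τ) = multiplier τ z * multiplier τ (z + y) * Φ z := by
    intro z
    simp only [hΦ, add_right_comm z _ y, tT, tD, tE]
    ring
  have T0 : T 0 = 0 := theta_zero τ
  have Φ0 : Φ 0 = 0 := by
    simp only [hΦ, zero_add, T0, z2]; ring
  have Φy : Φ (-y) = 0 := by
    have e1 : T (-y) = -T y := theta_neg y τ
    have e2 : D (-y) = D y := deriv_theta_neg y τ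
    simp only [hΦ, neg_add_cancel, T0, z2, e1, e2]; ring
  obtain ⟨d, dd, hd⟩ := exists_differentiable_mul_eq dθ dΦ (fun z => deriv_theta_ne_zero)
    (fun z hz => eq_zero_add_lattice (fun z => by rw [p1])
      (fun z => by rw [p2]; simp [multiplier_ne_zero]) Φ0 (theta_eq_zero_iff.1 hz))
  -- The quotient d = Φ/θ has the multipliers of θ(z + y) and vanishes at -y, so it is a constant
  -- multiple of θ(z + y).
  have d1 : (fun z => d (z + 1)) = fun z => -d z := by
    refine eq_of_theta_mul_eq (τ := τ) (by have := dd.continuous; fun_prop)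
      (by have := dd.continuous; fun_prop) fun z => ?_
    have h := hd (z + 1)
    rw [p1, hd, tT1] at h
    change T z * _ = T z * _
    linear_combination h
  have d2 : (fun z => d (z + τ)) = fun z => multiplier τ (z + y) * d z := by
    refine eq_of_theta_mul_eq (τ := τ) (by have := dd.continuous; fun_prop) ?_ fun z => ?_
    · have h1 := dd.continuous
      have h2 : Continuous (multiplier τ) := by unfold multiplier; fun_prop
      fun_prop
    · have h := hd (z + τ)
      rw [p2, hd, tT] at h
      refine mul_left_cancel₀ (multiplier_ne_zero τ z) ?_
      change _ * (T z * _) = _ * (T z * _)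
      linear_combination -h
  have dy : d (-y) = 0 := by
    have h := hd (-y)
    rw [Φy] at h
    rcases mul_eq_zero.1 h.symm with h | h
    · have e1 : T (-y) = -T y := theta_neg y τ
      rw [e1, neg_eq_zero] at h
      exact absurd h n0
    · exact h
  obtain ⟨C, hC⟩ := exists_eq_const_mul_theta (τ := τ) (g := fun z => d (z - y)) (by fun_prop)
    (by simpa using dy)
    (fun z => by rw [← congrFun d1 (z - y)]; ring_nf)
    (fun z => by
      have := congrFun d2 (z - y)
      simp only [sub_add_cancel] at this
      rw [add_sub_right_comm, this]; rfl)
  have hΦC : ∀ z, Φ z = C * (T z * T (z + y)) := fun z => by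
    have := hC (z + y)
    simp only [add_sub_cancel_right] at this
    rw [hd, this]; ring
  have S : ∀ {F : ℂ → ℂ} {F' : ℂ}, HasDerivAt F F' y → HasDerivAt (fun z => F (z + y)) F' 0 :=
    fun h => HasDerivAt.comp_add_const (x := 0) (a := y) (by simpa using h)
  have A1 := H1 0
  have A2 := H2 0
  have A3 := H3 0
  have B1 := S (H1 y)
  have B2 := S (H2 y)
  have B3 := S (H3 y)
  -- Comparing derivatives at 0: on the side of Φ all that survives is (θ'''(0) - λθ'(0)) θ(y)²,
  -- which is 0 by the choice of λ; the other side is Cθ'(0)θ(y).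
  have G1 : HasDerivAt Φ _ 0 :=
    ((((((A2.const_mul 2).mul B1).mul_const (D y)).sub
      ((B2.const_mul 2).mul ((A2.mul_const (T y)).add (A1.mul_const (D y))))).add
      ((A3.mul B1).mul_const (T y))).add ((A1.mul_const (E y)).mul B1)).add
      ((A1.mul_const (T y)).mul B3) |>.sub (((A1.mul_const (T y)).mul B1).const_mul lam)
  have G2 : HasDerivAt (fun z => C * (T z * T (z + y))) _ 0 := (A1.mul B1).const_mul C
  rw [← funext hΦC] at G2
  have G := G1.unique G2
  simp only [Pi.add_apply, T0, zero_add, z2] at G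
  have hC0 : C = 0 := by
    have : C * (D 0 * T y) = 0 := by linear_combination -G + T y ^ 2 * hl
    exact (mul_eq_zero.1 this).resolve_right (mul_ne_zero n1 n0)
  rw [hΦC, hC0, zero_mul]

lemma logDeriv_theta_neg (z : ℂ) (τ : ℍ) :
    logDeriv (fun z => theta z τ) (-z) = -logDeriv (fun z => theta z τ) z := by
  rw [logDeriv_apply, logDeriv_apply, deriv_theta_neg, theta_neg, div_neg]

lemma logDeriv_theta_add_int (z : ℂ) (m : ℤ) (τ : ℍ) :
    logDeriv (fun z => theta z τ) (z + m) = logDeriv (fun z => theta z τ) z := by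
  have hm : ((-1 : ℂ) ^ m) ≠ 0 := zpow_ne_zero _ (by norm_num)
  have h := deriv_comp_add_const (fun z => theta z τ) m z
  simp only [theta_add_int] at h
  rw [deriv_const_mul _ (differentiable_theta τ z)] at h
  rw [logDeriv_apply, logDeriv_apply, ← h, theta_add_int, mul_div_mul_left _ _ hm]

/-- Divide `theta_three_term` by θ(x)θ(y)θ(x+y). The three terms θ'''(0)/(3θ'(0)) in the `tFun` add
up to λ, and w carries a minus sign because it stands for the odd logarithmic derivative at -(x+y).
-/
lemma logDeriv_theta_quadratic {x y : ℂ} {τ : ℍ} (hx : x ∉ lattice τ) (hy : y ∉ lattice τ)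
    (hxy : x + y ∉ lattice τ) {u v w : ℂ}
    (hu : u = (2 * π * I)⁻¹ * logDeriv (fun z => theta z τ) x)
    (hv : v = (2 * π * I)⁻¹ * logDeriv (fun z => theta z τ) y)
    (hw : w = -((2 * π * I)⁻¹ * logDeriv (fun z => theta z τ) (x + y))) :
    u * v + v * w + w * u + tFun x τ + tFun y τ + tFun (x + y) τ = 0 := by
  have h := theta_three_term hy x
  have nx : theta x τ ≠ 0 := fun h => hx (theta_eq_zero_iff.1 h)
  have ny : theta y τ ≠ 0 := fun h => hy (theta_eq_zero_iff.1 h)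
  have nxy : theta (x + y) τ ≠ 0 := fun h => hxy (theta_eq_zero_iff.1 h)
  have n1 := deriv_theta_zero_ne_zero τ
  have hk := two_pi_I_ne_zero
  set k : ℂ := 2 * π * I
  rw [hu, hv, hw, tFun, tFun, tFun, logDeriv_apply, logDeriv_apply, logDeriv_apply,
    show (2 * π * I : ℂ) = k from rfl, zpow_neg, zpow_ofNat]
  field_simp at h ⊢
  linear_combination 3 * h

/-! ### Lambert series and the logarithmic derivative of theta. -/

section Lambert

variable {x : ℂ}

lemma tendsto_pow_succ_mul (hx : ‖x‖ < 1) (w : ℂ) :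
    Tendsto (fun l : ℕ => x ^ (l + 1) * w) atTop (𝓝 0) := by
  have h := ((tendsto_pow_atTop_nhds_zero_of_norm_lt_one hx).comp (tendsto_add_atTop_nat 1)).mul_const w
  simpa using h

/-- The inverses tend to 1, and a convergent sequence is bounded; a vanishing denominator
contributes the default value 0. -/
lemma exists_norm_inv_one_sub_le (hx : ‖x‖ < 1) (w : ℂ) :
    ∃ B : ℝ, 0 < B ∧ ∀ l : ℕ, ‖(1 - x ^ (l + 1) * w)⁻¹‖ ≤ B := by
  have h : Tendsto (fun l : ℕ => (1 - x ^ (l + 1) * w)⁻¹) atTop (𝓝 1) := by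
    simpa using ((tendsto_pow_succ_mul hx w).const_sub 1).inv₀ (by simp)
  obtain ⟨B, hB⟩ := (Metric.isBounded_range_of_tendsto _ h).exists_norm_le
  refine ⟨max B 1, by positivity, fun l => (hB _ ⟨l, rfl⟩).trans (le_max_left _ _)⟩

lemma summable_succ_mul_norm_pow (hx : ‖x‖ < 1) :
    Summable fun l : ℕ => ((l : ℝ) + 1) * ‖x‖ ^ (l + 1) := by
  have h := (summable_nat_add_iff 1).2
    (summable_pow_mul_geometric_of_norm_lt_one 1 (r := ‖x‖) (by simpa using hx))
  simpa using h

/-- The bound l + 1 on the coefficients covers both the plain and the weighted series. -/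
lemma summable_lambert (hx : ‖x‖ < 1) {c : ℕ → ℂ} (hc : ∀ l, ‖c l‖ ≤ l + 1) (w : ℂ) :
    Summable fun l : ℕ => c l * (x ^ (l + 1) * w / (1 - x ^ (l + 1) * w)) := by
  obtain ⟨B, hB, h⟩ := exists_norm_inv_one_sub_le hx w
  refine Summable.of_norm_bounded ((summable_succ_mul_norm_pow hx).mul_right (‖w‖ * B)) fun l => ?_
  rw [div_eq_mul_inv, norm_mul, norm_mul, norm_mul, norm_pow, mul_assoc, mul_assoc]
  gcongr
  · exact hc l
  · exact h l

lemma hasDerivAt_lambert (hx : ‖x‖ < 1) {c : ℕ → ℂ} (hc : ∀ l, ‖c l‖ ≤ l + 1) {w : ℂ}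
    (hw : ∀ l : ℕ, x ^ (l + 1) * w ≠ 1) :
    HasDerivAt (fun w => ∑' l : ℕ, c l * (x ^ (l + 1) * w / (1 - x ^ (l + 1) * w)))
      (∑' l : ℕ, c l * (x ^ (l + 1) / (1 - x ^ (l + 1) * w) ^ 2)) w := by
  obtain ⟨B, hB, h⟩ := exists_norm_inv_one_sub_le hx w
  -- The denominators at w are at least 1/B = 2δ, so on the ball of radius δ they remain at least δ.
  set δ : ℝ := (2 * B)⁻¹ with hδ
  have hδ0 : 0 < δ := by positivity
  have low : ∀ l : ℕ, 2 * δ ≤ ‖1 - x ^ (l + 1) * w‖ := fun l => by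
    have h1 : 0 < ‖1 - x ^ (l + 1) * w‖ := norm_pos_iff.2 (sub_ne_zero.2 (hw l).symm)
    have h2 := h l
    rw [norm_inv, inv_le_comm₀ h1 hB] at h2
    rw [hδ, mul_inv]
    linarith
  have low' : ∀ (l : ℕ), ∀ v ∈ Metric.ball w δ, δ ≤ ‖1 - x ^ (l + 1) * v‖ := fun l v hv => by
    have h1 : ‖v - w‖ < δ := by simpa [dist_eq_norm] using hv
    have h2 : ‖x ^ (l + 1) * (v - w)‖ ≤ ‖v - w‖ := by
      rw [norm_mul, norm_pow]
      exact mul_le_of_le_one_left (norm_nonneg _) (pow_le_one₀ (norm_nonneg _) hx.le)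
    have h3 : 1 - x ^ (l + 1) * w = (1 - x ^ (l + 1) * v) + x ^ (l + 1) * (v - w) := by ring
    have h4 := low l
    rw [h3] at h4
    linarith [norm_add_le (1 - x ^ (l + 1) * v) (x ^ (l + 1) * (v - w))]
  have ne : ∀ (l : ℕ), ∀ v ∈ Metric.ball w δ, 1 - x ^ (l + 1) * v ≠ 0 := fun l v hv =>
    norm_pos_iff.1 (hδ0.trans_le (low' l v hv))
  have hd : ∀ (l : ℕ), ∀ v ∈ Metric.ball w δ,
      HasDerivAt (fun w => c l * (x ^ (l + 1) * w / (1 - x ^ (l + 1) * w)))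
        (c l * (x ^ (l + 1) / (1 - x ^ (l + 1) * v) ^ 2)) v := fun l v hv => by
    have h1 : HasDerivAt (fun v => x ^ (l + 1) * v) (x ^ (l + 1)) v := by
      simpa using (hasDerivAt_id v).const_mul (x ^ (l + 1))
    have h2 := (h1.fun_div (h1.const_sub 1) (ne l v hv)).const_mul (c l)
    refine h2.congr_deriv ?_
    congr 2
    ring
  have hu := (summable_succ_mul_norm_pow hx).mul_right ((‖w‖ + δ) * δ⁻¹)
  have hdiff : ∀ l : ℕ, DifferentiableOn ℂ
      (fun w => c l * (x ^ (l + 1) * w / (1 - x ^ (l + 1) * w))) (Metric.ball w δ) :=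
    fun l v hv => (hd l v hv).differentiableAt.differentiableWithinAt
  have hle : ∀ (l : ℕ), ∀ v ∈ Metric.ball w δ,
      ‖c l * (x ^ (l + 1) * v / (1 - x ^ (l + 1) * v))‖ ≤
        (l + 1) * ‖x‖ ^ (l + 1) * ((‖w‖ + δ) * δ⁻¹) := fun l v hv => by
    have h1 : ‖v - w‖ < δ := by simpa [dist_eq_norm] using hv
    have h2 := norm_add_le w (v - w)
    rw [add_sub_cancel] at h2
    rw [div_eq_mul_inv, norm_mul, norm_mul, norm_mul, norm_pow, norm_inv, mul_assoc, mul_assoc]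
    gcongr
    · exact hc l
    · linarith
    · exact low' l v hv
  have hw' : w ∈ Metric.ball w δ := Metric.mem_ball_self hδ0
  have key := hasSum_deriv_of_summable_norm hu hdiff Metric.isOpen_ball hle hw'
  have hD := ((differentiableOn_tsum_of_summable_norm hu hdiff Metric.isOpen_ball
    hle).differentiableAt (Metric.isOpen_ball.mem_nhds hw')).hasDerivAt
  rw [← key.tsum_eq] at hD
  refine hD.congr_deriv (tsum_congr fun l => (hd l w hw').deriv)

/-- The Lambert series `∑_{l ≥ 1} x^l w / (1 - x^l w)`. -/
def lambert (x w : ℂ) : ℂ := ∑' l : ℕ, x ^ (l + 1) * w / (1 - x ^ (l + 1) * w)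

/-- The weighted Lambert series `∑_{l ≥ 1} l x^l w / (1 - x^l w)`. -/
def lambert' (x w : ℂ) : ℂ :=
  ∑' l : ℕ, ((l : ℂ) + 1) * (x ^ (l + 1) * w / (1 - x ^ (l + 1) * w))

lemma norm_succ_le (l : ℕ) : ‖(l : ℂ) + 1‖ ≤ l + 1 := by
  simpa using norm_add_le (l : ℂ) 1

lemma summable_lambert_one (hx : ‖x‖ < 1) (w : ℂ) :
    Summable fun l : ℕ => x ^ (l + 1) * w / (1 - x ^ (l + 1) * w) := by
  simpa using summable_lambert hx (c := fun _ => 1) (fun l => by simp) w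

lemma hasDerivAt_lambert_one (hx : ‖x‖ < 1) {w : ℂ} (hw : ∀ l : ℕ, x ^ (l + 1) * w ≠ 1) :
    HasDerivAt (lambert x) (∑' l : ℕ, x ^ (l + 1) / (1 - x ^ (l + 1) * w) ^ 2) w := by
  have h := hasDerivAt_lambert hx (c := fun _ => 1) (fun l => by simp) hw
  simp only [one_mul] at h
  exact h

lemma differentiableAt_lambert' (hx : ‖x‖ < 1) {w : ℂ} (hw : ∀ l : ℕ, x ^ (l + 1) * w ≠ 1) :
    DifferentiableAt ℂ (lambert' x) w :=
  (hasDerivAt_lambert hx norm_succ_le hw).differentiableAt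

lemma lambert_eq_add (hx : ‖x‖ < 1) (w : ℂ) :
    lambert x w = x * w / (1 - x * w) + lambert x (x * w) := by
  rw [lambert, (summable_lambert_one hx w).tsum_eq_zero_add, lambert]
  simp only [zero_add, pow_succ, pow_zero, one_mul, mul_assoc]

/-- Shifting the index lowers the weight l by one, and the difference is the unweighted series. This
is how a shift by τ produces θ'/θ. -/
lemma lambert'_mul (hx : ‖x‖ < 1) (w : ℂ) :
    lambert' x (x * w) = lambert' x w - lambert x w := by
  have h1 := summable_lambert hx norm_succ_le w
  have h2 := summable_lambert_one hx w
  rw [lambert', lambert', lambert, ← h1.tsum_sub h2, (h1.sub h2).tsum_eq_zero_add]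
  simp only [Nat.cast_zero, zero_add, one_mul, sub_self]
  refine tsum_congr fun l => ?_
  push_cast
  rw [← mul_assoc, ← pow_succ]
  ring

end Lambert

lemma logDeriv_qProd (τ : ℍ) {w : ℂ} (hw : ∀ l : ℕ, q τ ^ (l + 1) * w ≠ 1) :
    w * logDeriv (qProd τ) w = -lambert (q τ) w := by
  have hx := norm_q_lt_one τ
  have hterm : ∀ l : ℕ, logDeriv (fun w => 1 - q τ ^ (l + 1) * w) w =
      -(q τ ^ (l + 1) / (1 - q τ ^ (l + 1) * w)) := fun l => by
    have h1 : HasDerivAt (fun v => 1 - q τ ^ (l + 1) * v) (-q τ ^ (l + 1)) w := by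
      simpa using ((hasDerivAt_id w).const_mul (q τ ^ (l + 1))).const_sub 1
    rw [logDeriv_apply, h1.deriv, neg_div]
  have hu : Summable fun l : ℕ => ‖q τ ^ (l + 1)‖ * (‖w‖ + 1) := (summable_q τ).mul_right _
  have hm := (Summable.multipliableLocallyUniformlyOn_nat_one_add (K := Metric.ball w 1)
    (f := fun (l : ℕ) (w : ℂ) => -(q τ ^ (l + 1) * w)) Metric.isOpen_ball hu
    (.of_forall fun l x hx => by
      rw [norm_neg, norm_mul]
      gcongr
      have h1 : ‖x - w‖ < 1 := by simpa [dist_eq_norm] using hx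
      have h2 := norm_add_le w (x - w)
      rw [add_sub_cancel] at h2
      linarith) (fun l => by fun_prop))
  simp only [← sub_eq_add_neg] at hm
  have hs : Summable fun l : ℕ => logDeriv (fun w => 1 - q τ ^ (l + 1) * w) w := by
    simp only [hterm]
    obtain ⟨B, hB, h⟩ := exists_norm_inv_one_sub_le hx w
    refine Summable.of_norm_bounded ((summable_q τ).mul_right B) fun l => ?_
    rw [norm_neg, div_eq_mul_inv, norm_mul]
    gcongr
    exact h l
  have h := logDeriv_tprod_eq_tsum Metric.isOpen_ball (Metric.mem_ball_self one_pos)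
    (f := fun (l : ℕ) w => 1 - q τ ^ (l + 1) * w) (fun l => sub_ne_zero.2 (hw l).symm)
    (fun l => by fun_prop) hs hm (qProd_ne_zero τ hw)
  rw [show logDeriv (qProd τ) w = _ from h, ← tsum_mul_left, lambert, ← tsum_neg]
  refine tsum_congr fun l => ?_
  rw [hterm]; ring

/-- The points where the factors of `thetaProd` do not vanish. -/
lemma q_pow_mul_exp_ne_one {z : ℂ} {τ : ℍ} (hz : thetaProd τ z ≠ 0) (l : ℕ) :
    q τ ^ (l + 1) * exp (2 * π * I * z) ≠ 1 ∧ q τ ^ (l + 1) * exp (-(2 * π * I * z)) ≠ 1 := by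
  have key : ∀ w : ℂ, qProd τ w ≠ 0 → q τ ^ (l + 1) * w ≠ 1 := fun w hw h =>
    hw (tprod_of_exists_eq_zero ⟨l, by rw [h, sub_self]⟩)
  exact ⟨key _ (left_ne_zero_of_mul hz), key _ (right_ne_zero_of_mul hz)⟩

lemma deriv_thetaProd {z : ℂ} {τ : ℍ} (hz : thetaProd τ z ≠ 0) :
    deriv (thetaProd τ) z = thetaProd τ z * (-(2 * π * I) *
      (lambert (q τ) (exp (2 * π * I * z)) - lambert (q τ) (exp (-(2 * π * I * z))))) := by
  have h1 : HasDerivAt (fun z => exp (2 * π * I * z)) (2 * π * I * exp (2 * π * I * z)) z := by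
    have := ((hasDerivAt_id z).const_mul (2 * π * I : ℂ)).cexp
    simpa [mul_comm] using this
  have h2 : HasDerivAt (fun z => exp (-(2 * π * I * z)))
      (-(2 * π * I) * exp (-(2 * π * I * z))) z := by
    have := ((hasDerivAt_id z).const_mul (2 * π * I : ℂ)).neg.cexp
    simpa [mul_comm] using this
  have d := differentiable_qProd τ
  have h3 := ((d (exp (2 * π * I * z))).hasDerivAt.comp z h1).mul
    ((d (exp (-(2 * π * I * z)))).hasDerivAt.comp z h2)
  have h4 : deriv (thetaProd τ) z = _ := h3.deriv
  have l1 := logDeriv_qProd τ fun l => (q_pow_mul_exp_ne_one hz l).1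
  have l2 := logDeriv_qProd τ fun l => (q_pow_mul_exp_ne_one hz l).2
  have n1 : qProd τ (exp (2 * π * I * z)) ≠ 0 := left_ne_zero_of_mul hz
  have n2 : qProd τ (exp (-(2 * π * I * z))) ≠ 0 := right_ne_zero_of_mul hz
  rw [logDeriv_apply, ← mul_div_assoc, div_eq_iff n1] at l1
  rw [logDeriv_apply, ← mul_div_assoc, div_eq_iff n2] at l2
  rw [h4, thetaProd]
  simp only [Function.comp_apply]
  linear_combination (2 * π * I * qProd τ (exp (-(2 * π * I * z)))) * l1 -
    (2 * π * I * qProd τ (exp (2 * π * I * z))) * l2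

lemma deriv_theta (z : ℂ) (τ : ℍ) : deriv (fun z => theta z τ) z = thetaConst τ *
    (2 * (π * cos (π * z))) * thetaProd τ z +
    thetaConst τ * (2 * sin (π * z)) * deriv (thetaProd τ) z := by
  have h1 : HasDerivAt (fun z : ℂ => sin (π * z)) (π * cos (π * z)) z := by
    have := ((hasDerivAt_id z).const_mul (π : ℂ)).csin
    simpa [mul_comm] using this
  have h := ((h1.const_mul 2).const_mul (thetaConst τ)).mul
    (differentiable_thetaProd τ z).hasDerivAt
  rw [show (fun z => theta z τ) = _ from funext fun z => theta_eq z τ]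
  exact h.deriv

lemma thetaProd_ne_zero {z : ℂ} {τ : ℍ} (hz : z ∉ lattice τ) : thetaProd τ z ≠ 0 := by
  rw [← theta_eq_zero_iff, theta_eq] at hz
  exact right_ne_zero_of_mul hz

/-- The partial fraction expansion of the logarithmic derivative of `theta`. -/
lemma logDeriv_theta {z : ℂ} {τ : ℍ} (hz : z ∉ lattice τ) :
    logDeriv (fun z => theta z τ) z = 2 * π * I * (1 / 2 + (exp (2 * π * I * z) - 1)⁻¹ -
      (lambert (q τ) (exp (2 * π * I * z)) - lambert (q τ) (exp (-(2 * π * I * z))))) := by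
  have hP := thetaProd_ne_zero hz
  have hθ : theta z τ ≠ 0 := fun h => hz (theta_eq_zero_iff.1 h)
  have hs : sin (π * z) ≠ 0 := by
    intro h; rw [theta_eq, h] at hθ; simp at hθ
  have hw : exp (2 * π * I * z) = exp (π * I * z) ^ 2 := by
    rw [← exp_nat_mul]; congr 1; push_cast; ring
  have hc : cos (π * z) = (exp (π * I * z) + (exp (π * I * z))⁻¹) / 2 := by
    rw [cos, ← exp_neg]; ring_nf
  have hs' : sin (π * z) = ((exp (π * I * z))⁻¹ - exp (π * I * z)) * I / 2 := by
    rw [sin, ← exp_neg]; ring_nf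
  -- The sine factor contributes π cot πz, rewritten as a rational function of exp(2πiz).
  have hcot : π * cos (π * z) = sin (π * z) *
      (2 * π * I * (1 / 2 + (exp (2 * π * I * z) - 1)⁻¹)) := by
    have e0 : exp (π * I * z) ≠ 0 := exp_ne_zero _
    have e1 : exp (π * I * z) ^ 2 - 1 ≠ 0 := by
      intro h
      apply hs
      rw [hs']
      have : (exp (π * I * z))⁻¹ = exp (π * I * z) := by
        field_simp; linear_combination -h
      rw [this]; simp
    rw [hw, hc, hs']
    field_simp
    linear_combination (exp (π * I * z) ^ 4 - 1) * I_sq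
  rw [logDeriv_apply, div_eq_iff hθ, deriv_theta, deriv_thetaProd hP, theta_eq]
  linear_combination 2 * thetaConst τ * thetaProd τ z * hcot

/-! ### Lambert series as double series and as power series in q. -/

section DoubleSeries

variable {x w : ℂ}

/-- The double series `∑ l x^{k l} w^k` over `(k, l)`. -/
lemma summable_double (hx : ‖x‖ < 1) (hw : ‖w‖ ≤ 1) :
    Summable fun c : ℕ+ × ℕ+ => (c.2 : ℂ) * x ^ (c.1 * c.2 : ℕ) * w ^ (c.1 : ℕ) := by
  have h := summable_prod_mul_pow 1 (r := ‖x‖) (by simpa using hx)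
  refine Summable.of_norm_bounded h fun c => ?_
  rw [norm_mul, norm_mul, norm_pow, norm_pow, pow_one]
  simp only [norm_natCast]
  exact mul_le_of_le_one_right (by positivity) (pow_le_one₀ (norm_nonneg _) hw)

lemma norm_pow_pnat_mul_lt_one (hx : ‖x‖ < 1) (hw : ‖w‖ ≤ 1) (l : ℕ+) :
    ‖x ^ (l : ℕ) * w‖ < 1 := by
  rw [norm_mul, norm_pow]
  exact mul_lt_one_of_nonneg_of_lt_one_left (by positivity)
    (pow_lt_one₀ (norm_nonneg _) hx l.ne_zero) hw

lemma tsum_pnat_pow {y : ℂ} (hy : ‖y‖ < 1) : ∑' k : ℕ+, y ^ (k : ℕ) = y / (1 - y) := by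
  rw [tsum_pnat_eq_tsum_succ (f := fun k => y ^ k)]
  simp only [pow_succ, tsum_mul_right, tsum_geometric_of_norm_lt_one hy]
  rw [mul_comm, div_eq_mul_inv]

lemma tsum_pnat_mul_pow {y : ℂ} (hy : ‖y‖ < 1) :
    ∑' k : ℕ+, (k : ℂ) * y ^ (k : ℕ) = y / (1 - y) ^ 2 := by
  rw [← tsum_coe_mul_geometric_of_norm_lt_one hy]
  have h := (hasSum_coe_mul_geometric_of_norm_lt_one hy).summable
  rw [h.tsum_eq_zero_add, tsum_pnat_eq_tsum_succ (f := fun k => (k : ℂ) * y ^ k)]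
  simp

/-- Expand each term geometrically: l is the Lambert index and k the geometric exponent. The case
|w| = 1, needed for roots of unity, is included since |x| < 1. -/
lemma lambert'_eq_tsum_double (hx : ‖x‖ < 1) (hw : ‖w‖ ≤ 1) : lambert' x w =
    ∑' c : ℕ+ × ℕ+, (c.2 : ℂ) * x ^ (c.1 * c.2 : ℕ) * w ^ (c.1 : ℕ) := by
  have h := summable_double hx hw
  have e0 := Summable.tsum_comm (f := fun k l : ℕ+ =>
    (l : ℂ) * x ^ (k * l : ℕ) * w ^ (k : ℕ)) h
  refine Eq.trans ?_ (e0.trans h.tsum_prod.symm)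
  rw [lambert']
  have e := tsum_pnat_eq_tsum_succ (f := fun l : ℕ => (l : ℂ) * (x ^ l * w / (1 - x ^ l * w)))
  push_cast at e
  rw [← e]
  refine tsum_congr fun l => ?_
  rw [← tsum_pnat_pow (norm_pow_pnat_mul_lt_one hx hw l), ← tsum_mul_left]
  refine tsum_congr fun k => ?_
  rw [mul_pow, ← pow_mul, mul_comm (l : ℕ), mul_assoc]

/-- At w = 1 the same double series is summed over l first. The result is the derivative of `lambert
x` at 1, which enters θ'''(0). -/
lemma lambert'_one (hx : ‖x‖ < 1) : lambert' x 1 =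
    ∑' l : ℕ, x ^ (l + 1) / (1 - x ^ (l + 1) * 1) ^ 2 := by
  have h := summable_double hx (w := 1) (by simp)
  rw [lambert'_eq_tsum_double hx (by simp), h.tsum_prod]
  have e := tsum_pnat_eq_tsum_succ (f := fun l : ℕ => (x ^ l / (1 - x ^ l * 1) ^ 2))
  rw [← e]
  refine tsum_congr fun k => ?_
  have hk := norm_pow_pnat_mul_lt_one hx (w := 1) (by simp) k
  rw [mul_one] at hk
  rw [mul_one, ← tsum_pnat_mul_pow hk]
  refine tsum_congr fun l => ?_
  rw [one_pow, mul_one, pow_mul]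

/-- Group the double series by d = kl, so that the weight l becomes d/k. -/
lemma hasSum_lambert' (hx : ‖x‖ < 1) (hw : ‖w‖ ≤ 1) :
    HasSum (fun d : ℕ+ => x ^ (d : ℕ) * ∑ k ∈ (d : ℕ).divisors, ((d : ℕ) : ℂ) / (k : ℂ) * w ^ k)
      (lambert' x w) := by
  have h := (summable_double hx hw).hasSum
  rw [← lambert'_eq_tsum_double hx hw, ← sigmaAntidiagonalEquivProd.hasSum_iff] at h
  convert h.sigma fun d => hasSum_fintype _ using 1
  funext d
  simp only [Function.comp_apply, sigmaAntidiagonalEquivProd, divisorsAntidiagonalFactors,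
    Equiv.coe_fn_mk, PNat.mk_coe, Finset.univ_eq_attach]
  rw [(d : ℕ).divisorsAntidiagonal.sum_attach
      fun c : ℕ × ℕ => (c.2 : ℂ) * x ^ (c.1 * c.2) * w ^ c.1,
    Nat.sum_divisorsAntidiagonal fun k l => (l : ℂ) * x ^ (k * l) * w ^ k, Finset.mul_sum]
  refine Finset.sum_congr rfl fun k hk => ?_
  have hd := Nat.dvd_of_mem_divisors hk
  have hk0 : (k : ℂ) ≠ 0 := by exact_mod_cast (Nat.pos_of_mem_divisors hk).ne'
  rw [Nat.mul_div_cancel' hd, Nat.cast_div hd hk0]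
  ring

end DoubleSeries

/-! ### The q-expansion of t_a. -/

/-- Differentiate the formula for P', valid near 0 because P(0) ≠ 0. Its bracket vanishes at 0, so
only the derivative of the bracket counts. -/
lemma deriv_deriv_thetaProd_zero (τ : ℍ) : deriv (deriv (thetaProd τ)) 0 =
    -2 * (2 * π * I) ^ 2 * thetaProd τ 0 * lambert' (q τ) 1 := by
  have hx := norm_q_lt_one τ
  have hP := thetaProd_zero_ne_zero τ
  have hev : deriv (thetaProd τ) =ᶠ[𝓝 0] fun z => thetaProd τ z * (-(2 * π * I) *
      (lambert (q τ) (exp (2 * π * I * z)) - lambert (q τ) (exp (-(2 * π * I * z))))) := by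
    filter_upwards [(differentiable_thetaProd τ 0).continuousAt.eventually_ne hP] with z hz
    exact deriv_thetaProd hz
  rw [hev.deriv_eq]
  have h1 : HasDerivAt (fun z : ℂ => exp (2 * π * I * z)) (2 * π * I) 0 := by
    have := ((hasDerivAt_id (0 : ℂ)).const_mul (2 * π * I : ℂ)).cexp
    simpa [mul_comm] using this
  have h2 : HasDerivAt (fun z : ℂ => exp (-(2 * π * I * z))) (-(2 * π * I)) 0 := by
    have := ((hasDerivAt_id (0 : ℂ)).const_mul (2 * π * I : ℂ)).neg.cexp
    simpa [mul_comm] using this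
  have hl : HasDerivAt (lambert (q τ)) (lambert' (q τ) 1) 1 := by
    rw [lambert'_one hx]
    refine hasDerivAt_lambert_one hx fun l => ?_
    simpa using (q_pow_mul_exp_ne_one hP l).1
  have c1 := HasDerivAt.comp (0 : ℂ) (h₂ := lambert (q τ)) (by simpa using hl) h1
  have c2 := HasDerivAt.comp (0 : ℂ) (h₂ := lambert (q τ)) (by simpa using hl) h2
  have h3 := (differentiable_thetaProd τ 0).hasDerivAt.mul ((c1.sub c2).const_mul (-(2 * π * I)))
  refine h3.deriv.trans ?_
  simp
  ring

lemma deriv_thetaProd_zero (τ : ℍ) : deriv (thetaProd τ) 0 = 0 := by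
  rw [deriv_thetaProd (thetaProd_zero_ne_zero τ)]
  simp

/-- With θ = 2c sin(πz) P(z) and P'(0) = 0, one gets θ'''(0)/θ'(0) = -π² + 3P''(0)/P(0), and -π² =
3(2πi)²/12 is the source of the 1/12. -/
lemma iteratedDeriv_three_theta_zero (τ : ℍ) : iteratedDeriv 3 (fun z => theta z τ) 0 =
    3 * (2 * π * I) ^ 2 * (1 / 12 - 2 * lambert' (q τ) 1) * deriv (fun z => theta z τ) 0 := by
  have dP := differentiable_thetaProd τ
  have hs : ∀ z : ℂ, HasDerivAt (fun z : ℂ => sin (π * z)) (π * cos (π * z)) z := fun z => by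
    have := ((hasDerivAt_id z).const_mul (π : ℂ)).csin
    simpa [mul_comm] using this
  have hc : ∀ z : ℂ, HasDerivAt (fun z : ℂ => cos (π * z)) (-(π * sin (π * z))) z := fun z => by
    have := ((hasDerivAt_id z).const_mul (π : ℂ)).ccos
    simpa [mul_comm] using this
  have P0 : ∀ z, HasDerivAt (thetaProd τ) (deriv (thetaProd τ) z) z := fun z => (dP z).hasDerivAt
  have P1 : ∀ z, HasDerivAt (deriv (thetaProd τ)) (deriv (deriv (thetaProd τ)) z) z :=
    fun z => (dP.deriv z).hasDerivAt
  have P2 : ∀ z, HasDerivAt (deriv (deriv (thetaProd τ)))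
      (deriv (deriv (deriv (thetaProd τ))) z) z := fun z => (dP.deriv.deriv z).hasDerivAt
  set c := thetaConst τ
  have d1 : deriv (fun z => theta z τ) = fun z => c * (2 * (π * cos (π * z))) * thetaProd τ z +
      c * (2 * sin (π * z)) * deriv (thetaProd τ) z := funext fun z => deriv_theta z τ
  have d2 : deriv (deriv fun z => theta z τ) = fun z =>
      c * (2 * (π * -(π * sin (π * z)))) * thetaProd τ z +
        c * (2 * (π * cos (π * z))) * deriv (thetaProd τ) z +
      (c * (2 * (π * cos (π * z))) * deriv (thetaProd τ) z +
        c * (2 * sin (π * z)) * deriv (deriv (thetaProd τ)) z) := by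
    rw [d1]
    funext z
    exact (((((hc z).const_mul (π : ℂ)).const_mul 2).const_mul c).mul (P0 z) |>.add
      ((((hs z).const_mul 2).const_mul c).mul (P1 z))).deriv
  have d3 := ((((((hs 0).const_mul (π : ℂ)).fun_neg.const_mul (π : ℂ)).const_mul 2).const_mul c).mul (P0 0)
    |>.add ((((((hc 0).const_mul (π : ℂ)).const_mul 2).const_mul c).mul (P1 0)))
    |>.add ((((((hc 0).const_mul (π : ℂ)).const_mul 2).const_mul c).mul (P1 0)) |>.add
      ((((hs 0).const_mul 2).const_mul c).mul (P2 0)))).deriv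
  simp only [iteratedDeriv_succ, iteratedDeriv_zero]
  rw [d2]
  refine d3.trans ?_
  rw [d1]
  simp only [mul_zero, sin_zero, cos_zero, deriv_thetaProd_zero, deriv_deriv_thetaProd_zero]
  linear_combination (-c * π ^ 3 * thetaProd τ 0 * 2) * I_sq

/-- The Lambert series expansion of `tFun`. -/
def tSeries (τ : ℍ) (z : ℂ) : ℂ :=
  1 / 12 - lambert' (q τ) (exp (2 * π * I * z)) - lambert' (q τ) (exp (-(2 * π * I * z)))

lemma differentiableAt_tSeries {τ : ℍ} {z : ℂ} (hz : thetaProd τ z ≠ 0) :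
    DifferentiableAt ℂ (tSeries τ) z := by
  have hx := norm_q_lt_one τ
  have h1 := differentiableAt_lambert' hx fun l => (q_pow_mul_exp_ne_one hz l).1
  have h2 := differentiableAt_lambert' hx fun l => (q_pow_mul_exp_ne_one hz l).2
  have e1 : DifferentiableAt ℂ (fun z : ℂ => exp (2 * π * I * z)) z := by fun_prop
  have e2 : DifferentiableAt ℂ (fun z : ℂ => exp (-(2 * π * I * z))) z := by fun_prop
  exact ((h1.comp z e1).const_sub _).sub (h2.comp z e2)

lemma tSeries_add_one (τ : ℍ) (z : ℂ) : tSeries τ (z + 1) = tSeries τ z := by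
  have h1 : exp (2 * π * I * (z + 1)) = exp (2 * π * I * z) := by
    rw [mul_add, exp_add, mul_one, exp_two_pi_mul_I, mul_one]
  simp only [tSeries, exp_neg, h1]

lemma tSeries_add_tau {τ : ℍ} {z : ℂ} (hz : z ∉ lattice τ) : tSeries τ (z + τ) =
    tSeries τ z + 1 / 2 - (2 * π * I)⁻¹ * logDeriv (fun z => theta z τ) z := by
  have hx := norm_q_lt_one τ
  have hw0 : exp (2 * π * I * z) ≠ 0 := exp_ne_zero _
  have h1 : exp (2 * π * I * (z + τ)) = q τ * exp (2 * π * I * z) := by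
    rw [mul_add, exp_add, q, mul_comm]
  rw [logDeriv_theta hz, inv_mul_cancel_left₀ two_pi_I_ne_zero]
  have hw1 : exp (2 * π * I * z) - 1 ≠ 0 := by
    rw [sub_ne_zero, Ne, exp_eq_one_iff]
    rintro ⟨n, hn⟩
    refine hz ⟨n, 0, mul_left_cancel₀ two_pi_I_ne_zero ?_⟩
    rw [hn]; push_cast; ring
  simp only [tSeries, exp_neg, h1]
  set w := exp (2 * π * I * z)
  have hq := q_ne_zero τ
  have hv : q τ * (q τ * w)⁻¹ = w⁻¹ := by field_simp
  have a1 := lambert'_mul hx w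
  have a2 := lambert'_mul hx (q τ * w)⁻¹
  have a3 := lambert_eq_add hx (q τ * w)⁻¹
  rw [hv] at a2 a3
  have a4 : w⁻¹ / (1 - w⁻¹) = (w - 1)⁻¹ := by field_simp
  rw [a4] at a3
  linear_combination -a1 + a2 - a3

/-- By `tSeries_add_tau` both terms change by the same amount under z ↦ z + τ, so the difference is
elliptic. Its singularity at 0 is removable because θ''(0) = 0, and θ''/θ takes the value
θ'''(0)/θ'(0) there. -/
lemma iteratedDeriv_two_div_theta_eq {τ : ℍ} {z : ℂ} (hz : z ∉ lattice τ) :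
    iteratedDeriv 2 (fun z => theta z τ) z / theta z τ - 2 * (2 * π * I) ^ 2 * tSeries τ z =
      iteratedDeriv 3 (fun z => theta z τ) 0 / deriv (fun z => theta z τ) 0 -
        2 * (2 * π * I) ^ 2 * tSeries τ 0 := by
  have dθ := differentiable_theta τ
  have d2 : Differentiable ℂ (iteratedDeriv 2 fun z => theta z τ) := by
    simp only [iteratedDeriv_succ, iteratedDeriv_zero]
    exact dθ.deriv.deriv
  have ne : ∀ z, z ∉ lattice τ → theta z τ ≠ 0 := fun z hz h => hz (theta_eq_zero_iff.1 h)
  have hds : ∀ {f : ℂ → ℂ}, Differentiable ℂ f → DifferentiableAt ℂ (dslope f 0) 0 := fun hf =>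
    ((differentiableOn_dslope univ_mem).2 hf.differentiableOn).differentiableAt univ_mem
  have n0 : dslope (fun z => theta z τ) 0 0 ≠ 0 := by
    rw [dslope_same]; exact deriv_theta_zero_ne_zero τ
  have key := eq_of_periodic_compl_lattice (τ := τ)
    (f := fun z => iteratedDeriv 2 (fun z => theta z τ) z / theta z τ -
      2 * (2 * π * I) ^ 2 * tSeries τ z)
    (g := fun z => dslope (iteratedDeriv 2 fun z => theta z τ) 0 z /
      dslope (fun z => theta z τ) 0 z - 2 * (2 * π * I) ^ 2 * tSeries τ z)
    (fun z hz => ((d2 z).div (dθ z) (ne z hz)).sub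
      ((differentiableAt_tSeries (thetaProd_ne_zero hz)).const_mul _))
    (fun z hz => by
      rw [iteratedDeriv_two_theta_add_one, theta_add_one, tSeries_add_one, neg_div_neg_eq])
    (fun z hz => by
      have hm := multiplier_ne_zero τ z
      have hθ := ne z hz
      have hk := two_pi_I_ne_zero
      have e : theta (z + τ) τ = multiplier τ z * theta z τ := theta_add_tau z τ
      rw [iteratedDeriv_two_theta_add_tau, e, tSeries_add_tau hz, mul_div_mul_left _ _ hm,
        logDeriv_apply]
      set k : ℂ := 2 * π * I
      field_simp
      ring)
    (((hds d2).div (hds dθ) n0).sub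
      ((differentiableAt_tSeries (thetaProd_zero_ne_zero τ)).const_mul _))
    (by
      filter_upwards [self_mem_nhdsWithin] with w hw
      have hw : w ≠ 0 := hw
      rw [dslope_of_ne _ hw, dslope_of_ne _ hw, slope_def_field, slope_def_field,
        iteratedDeriv_two_theta_zero, theta_zero, sub_zero, sub_zero, sub_zero,
        div_div_div_cancel_right₀ hw])
    hz
  rw [key, dslope_same, dslope_same]
  simp only [iteratedDeriv_succ, iteratedDeriv_zero]

lemma tFun_eq_tSeries {τ : ℍ} {z : ℂ} (hz : z ∉ lattice τ) : tFun z τ = tSeries τ z := by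
  have h := iteratedDeriv_two_div_theta_eq hz
  have n1 := deriv_theta_zero_ne_zero τ
  have hk := two_pi_I_ne_zero
  have h0 : tSeries τ 0 = 1 / 12 - 2 * lambert' (q τ) 1 := by
    simp [tSeries]; ring
  rw [iteratedDeriv_three_theta_zero, mul_div_cancel_right₀ _ n1, h0] at h
  rw [tFun, iteratedDeriv_three_theta_zero, zpow_neg, zpow_ofNat, mul_div_mul_right _ _ n1]
  set k : ℂ := 2 * π * I
  rw [show iteratedDeriv 2 (fun z => theta z τ) z / theta z τ = 2 * k ^ 2 * tSeries τ z +
    k ^ 2 * (1 / 12 - 2 * lambert' (q τ) 1) by linear_combination h]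
  field_simp
  ring

lemma hasSum_tTerm {p : ℕ} (hp : p ≠ 0) {a : ℤ} (ha : ¬ (p : ℤ) ∣ a) (τ : ℍ) :
    HasSum (tTerm p a τ) (1 / 12 - t p a τ) := by
  have hx := norm_q_lt_one τ
  have hw : ∀ a : ℤ, exp (2 * π * I * (a / p)) = xi p ^ a := fun a => by
    rw [xi, ← exp_int_mul]; congr 1; ring
  have hn : ∀ a : ℤ, ‖xi p ^ a‖ ≤ 1 := fun a => by
    rw [← hw, show (2 * π * I * (a / p) : ℂ) = ((2 * π * (a / p) : ℝ) : ℂ) * I by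
      push_cast; ring, norm_exp_ofReal_mul_I]
  have h1 := hasSum_lambert' hx (hn a)
  have h2 := hasSum_lambert' hx (hn (-a))
  have h := h1.add h2
  rw [t_eq_tFun, tFun_eq_tSeries ((div_mem_lattice_iff hp).not.2 ha), tSeries, exp_neg, hw,
    ← zpow_neg]
  convert h using 1
  · funext d
    rw [tTerm, ← mul_add, ← Finset.sum_add_distrib]
    congr 1
    refine Finset.sum_congr rfl fun k _ => ?_
    rw [← zpow_natCast, ← zpow_natCast, ← zpow_mul, ← zpow_mul, neg_mul]
    ring
  · ring

/-! ### Growth and behaviour at the cusps. -/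

lemma isZeroAtImInfty_of_norm_le {h : ℍ → ℂ} {u : ℝ → ℝ} (hu : Tendsto u atTop (𝓝 0))
    (hh : ∀ τ : ℍ, 1 ≤ τ.im → ‖h τ‖ ≤ u τ.im) : UpperHalfPlane.IsZeroAtImInfty h := by
  have h1 : Tendsto (fun τ : ℍ => u τ.im) UpperHalfPlane.atImInfty (𝓝 0) :=
    hu.comp tendsto_comap
  refine squeeze_zero_norm' ?_ h1
  rw [UpperHalfPlane.atImInfty, Filter.Eventually, mem_comap]
  exact ⟨Set.Ici 1, Ici_mem_atTop 1, fun τ hτ => hh τ hτ⟩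

/-- A periodic holomorphic function of polynomial growth is bounded at infinity. -/
lemma isBoundedAtImInfty_of_polynomial_growth {g : ℍ → ℂ} {h : ℝ} (hh : 0 < h)
    (hper : Function.Periodic (g ∘ UpperHalfPlane.ofComplex) h) (hg : MDiff g) {A : ℝ} {N : ℕ}
    (hA : ∀ τ : ℍ, 1 ≤ τ.im → ‖g τ‖ ≤ A * τ.im ^ N) : UpperHalfPlane.IsBoundedAtImInfty g := by
  -- Multiplied by the local parameter e, the function g tends to 0; being periodic and holomorphic,
  -- the product is then O(|e|), and dividing by e bounds g.
  set e : ℍ → ℂ := fun τ => Function.Periodic.qParam h τ with he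
  have hc : 0 < 2 * π / h := by positivity
  have hne : ∀ τ : ℍ, ‖e τ‖ = Real.exp (-(2 * π / h * τ.im)) := fun τ => by
    rw [he, Function.Periodic.norm_qParam, UpperHalfPlane.coe_im]
    congr 1; ring
  have hed : MDiff e := by
    rw [UpperHalfPlane.mdifferentiable_iff]
    refine (Function.Periodic.differentiable_qParam (h := h)).differentiableOn.congr fun z hz => ?_
    simp [e, UpperHalfPlane.ofComplex_apply_of_im_pos hz]
  have hz : UpperHalfPlane.IsZeroAtImInfty (g * e) := by
    refine isZeroAtImInfty_of_norm_le (u := fun y => A * (y ^ N * Real.exp (-(2 * π / h * y)))) ?_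
      fun τ hτ => ?_
    · have := (isLittleO_pow_exp_pos_mul_atTop N hc).tendsto_div_nhds_zero.const_mul A
      simp only [mul_zero, div_eq_mul_inv, ← Real.exp_neg] at this
      exact this
    · rw [Pi.mul_apply, norm_mul, hne, ← mul_assoc]
      gcongr
      exact hA τ hτ
  have hp : Function.Periodic ((g * e) ∘ UpperHalfPlane.ofComplex) h := by
    intro z
    have h1 := hper z
    simp only [Function.comp_apply, Pi.mul_apply] at h1 ⊢
    rw [h1]
    by_cases hz : 0 < z.im
    · have hz' : 0 < (z + h).im := by simpa using hz
      simp only [e, UpperHalfPlane.ofComplex_apply_of_im_pos hz,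
        UpperHalfPlane.ofComplex_apply_of_im_pos hz']
      congr 1
      have hc0 : (h : ℂ) ≠ 0 := ofReal_ne_zero.2 hh.ne'
      rw [Function.Periodic.qParam, Function.Periodic.qParam, mul_add, add_div,
        mul_div_cancel_right₀ _ hc0, exp_add, exp_two_pi_mul_I, mul_one]
    · have hz' : (z + h).im ≤ 0 := by simpa using hz
      rw [UpperHalfPlane.ofComplex_apply_of_im_nonpos (not_lt.1 hz),
        UpperHalfPlane.ofComplex_apply_of_im_nonpos hz']
  have hO := hz.exp_decay_atImInfty hh hp (hg.mul hed) hz.isBoundedAtImInfty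
  obtain ⟨C, hC⟩ := hO.bound
  refine Asymptotics.IsBigO.of_bound C ?_
  filter_upwards [hC] with τ hτ
  rw [Pi.mul_apply, norm_mul, hne, Real.norm_eq_abs, Real.abs_exp,
    show -2 * π * τ.im / h = -(2 * π / h * τ.im) by ring] at hτ
  simpa using le_of_mul_le_mul_right hτ (Real.exp_pos _)

/-- Powers of T^p lie in Γ(p), which is normal in SL₂(ℤ) and contained in Γ₁(p). Hence p is a period
of every translate of f, whatever the cusp. -/
lemma slash_T_zpow_smul {f : ℍ → ℂ} {p : ℕ} {k : ℤ}
    (hf : ∀ γ ∈ CongruenceSubgroup.Gamma1 p, f ∣[k] γ = f) (γ : SL(2, ℤ)) (n : ℤ) (τ : ℍ) :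
    (f ∣[k] γ) ((ModularGroup.T ^ ((p : ℤ) * n)) • τ) = (f ∣[k] γ) τ := by
  set T' := ModularGroup.T ^ ((p : ℤ) * n) with hT
  have h1 : T' ∈ CongruenceSubgroup.Gamma p := by
    simpa using CongruenceSubgroup.ModularGroup_T_pow_mem_Gamma p (p * n) (dvd_mul_right _ _)
  have h2 : γ * T' * γ⁻¹ ∈ CongruenceSubgroup.Gamma1 p := by
    have := (CongruenceSubgroup.Gamma_normal p).conj_mem T' h1 γ
    rw [CongruenceSubgroup.Gamma_mem] at this
    rw [CongruenceSubgroup.Gamma1_mem]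
    exact ⟨this.1, this.2.2.2, this.2.2.1⟩
  have h3 : (f ∣[k] γ) ∣[k] T' = f ∣[k] γ := by
    rw [← SlashAction.slash_mul, show γ * T' = γ * T' * γ⁻¹ * γ by group, SlashAction.slash_mul,
      hf _ h2]
  have h4 := congrFun h3 τ
  rw [ModularForm.SL_slash_apply] at h4
  have h5 : UpperHalfPlane.denom T' τ = 1 := by
    rw [ModularGroup.denom_apply, hT, ModularGroup.coe_T_zpow]
    simp
  rw [h5, one_zpow, mul_one] at h4
  exact h4

lemma isBoundedAtImInfty_slash {f : ℍ → ℂ} {p : ℕ} (hp : 0 < p) (hd : MDiff f)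
    (hf : ∀ γ ∈ CongruenceSubgroup.Gamma1 p, f ∣[(2 : ℤ)] γ = f) {A : ℝ} {N : ℕ} (hA0 : 0 ≤ A)
    (hA : ∀ τ : ℍ, ‖f τ‖ ≤ A * (1 + 1 / τ.im) ^ N) (γ : SL(2, ℤ)) :
    UpperHalfPlane.IsBoundedAtImInfty (f ∣[(2 : ℤ)] γ) := by
  have hT := slash_T_zpow_smul hf γ
  have hp' : (0 : ℝ) < p := by exact_mod_cast hp
  -- For |Re τ| ≤ p and Im τ ≥ 1 one has |τ| ≤ (p+1) Im τ, so |cτ+d| ≤ B Im τ and 1/Im γτ ≤ B² Im τ.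
  -- Periodicity reduces to this strip.
  set B : ℝ := |(γ 1 0 : ℝ)| * (p + 1) + |(γ 1 1 : ℝ)| with hB
  refine isBoundedAtImInfty_of_polynomial_growth (h := p) hp' ?_ (hd.slash 2 _)
    (A := A * (1 + B ^ 2) ^ N) (N := N) ?_
  · intro z
    by_cases hz : 0 < z.im
    · have hz' : 0 < (z + (p : ℝ)).im := by simpa using hz
      simp only [Function.comp_apply, UpperHalfPlane.ofComplex_apply_of_im_pos hz,
        UpperHalfPlane.ofComplex_apply_of_im_pos hz']
      rw [← hT 1 ⟨z, hz⟩]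
      refine congrArg _ (UpperHalfPlane.ext ?_)
      rw [ModularGroup.coe_T_zpow_smul_eq]
      simp
    · have hz' : (z + (p : ℝ)).im ≤ 0 := by simpa using hz
      simp only [Function.comp_apply, UpperHalfPlane.ofComplex_apply_of_im_nonpos (not_lt.1 hz),
        UpperHalfPlane.ofComplex_apply_of_im_nonpos hz']
  · have strip : ∀ τ : ℍ, |τ.re| ≤ p → 1 ≤ τ.im →
        ‖(f ∣[(2 : ℤ)] γ) τ‖ ≤ A * (1 + B ^ 2) ^ N * τ.im ^ N := by
      intro τ hre him
      set j := UpperHalfPlane.denom γ τ with hj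
      have hj' : j = γ 1 0 * τ + γ 1 1 := ModularGroup.denom_apply γ τ
      have hlow : 1 ≤ ‖j‖ := by
        by_cases hc : γ 1 0 = 0
        · have hdet := γ.det_coe
          rw [Matrix.det_fin_two, hc, mul_zero, sub_zero] at hdet
          have hd0 : γ 1 1 ≠ 0 := right_ne_zero_of_mul (hdet ▸ one_ne_zero)
          rw [hj', hc]
          simp only [Int.cast_zero, zero_mul, zero_add, norm_intCast]
          exact_mod_cast Int.one_le_abs hd0
        · have h1 : |j.im| ≤ ‖j‖ := abs_im_le_norm j
          rw [hj'] at h1 ⊢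
          simp only [add_im, mul_im, intCast_re, intCast_im, zero_mul, add_zero,
            UpperHalfPlane.coe_im, abs_mul] at h1
          have h2 : (1 : ℝ) ≤ |(γ 1 0 : ℝ)| := by exact_mod_cast Int.one_le_abs hc
          refine le_trans ?_ h1
          rw [abs_of_pos τ.im_pos]
          nlinarith
      have hup : ‖j‖ ≤ B * τ.im := by
        have h1 : ‖(τ : ℂ)‖ ≤ (p + 1) * τ.im := by
          have := norm_le_abs_re_add_abs_im (τ : ℂ)
          rw [UpperHalfPlane.coe_re, UpperHalfPlane.coe_im, abs_of_pos τ.im_pos] at this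
          nlinarith
        rw [hj']
        refine (norm_add_le _ _).trans ?_
        rw [norm_mul, norm_intCast, norm_intCast, hB, add_mul, mul_assoc]
        gcongr
        exact le_mul_of_one_le_right (abs_nonneg _) him
      have him' : (γ • τ).im = τ.im / ‖j‖ ^ 2 := by
        rw [ModularGroup.im_smul_eq_div_normSq, normSq_eq_norm_sq]
      rw [ModularForm.SL_slash_apply, norm_mul, norm_zpow, zpow_neg]
      have h3 : (‖j‖ ^ (2 : ℤ))⁻¹ ≤ 1 := inv_le_one_of_one_le₀ (one_le_zpow₀ hlow (by norm_num))
      have h4 : 1 + 1 / (γ • τ).im ≤ (1 + B ^ 2) * τ.im := by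
        rw [him', one_div_div]
        have : ‖j‖ ^ 2 / τ.im ≤ B ^ 2 * τ.im := by
          rw [div_le_iff₀ τ.im_pos]
          calc ‖j‖ ^ 2 ≤ (B * τ.im) ^ 2 := by gcongr
            _ = _ := by ring
        linarith
      have h5 : 0 < (γ • τ).im := (γ • τ).im_pos
      calc ‖f (γ • τ)‖ * (‖j‖ ^ (2 : ℤ))⁻¹ ≤ ‖f (γ • τ)‖ * 1 := by gcongr
        _ ≤ A * (1 + 1 / (γ • τ).im) ^ N := by rw [mul_one]; exact hA _
        _ ≤ A * ((1 + B ^ 2) * τ.im) ^ N := by gcongr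
        _ = _ := by rw [mul_pow]; ring
    intro τ him
    obtain ⟨n, hn⟩ := UpperHalfPlane.ModularGroup_T_zpow_mem_verticalStrip τ hp
    rw [← hT n, ← ModularGroup.im_T_zpow_smul τ ((p : ℤ) * n)]
    refine strip _ hn.1 ?_
    rwa [ModularGroup.im_T_zpow_smul]

/-- The coefficients of the `q`-expansion of `t_a`. -/
def tCoeff (p : ℕ) (a : ℤ) (d : ℕ) : ℂ :=
  ∑ k ∈ d.divisors, (d : ℂ) / (k : ℂ) * (xi p ^ (a * (k : ℤ)) + xi p ^ (-(a * (k : ℤ))))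

lemma norm_xi (p : ℕ) : ‖xi p‖ = 1 := by
  rw [xi, show (2 * π * I / p : ℂ) = ((2 * π / p : ℝ) : ℂ) * I by push_cast; ring,
    norm_exp_ofReal_mul_I]

lemma norm_tCoeff_le (p : ℕ) (a : ℤ) (d : ℕ) : ‖tCoeff p a d‖ ≤ 2 * (d : ℝ) ^ 2 := by
  have h : ‖tCoeff p a d‖ ≤ ∑ k ∈ d.divisors, (d : ℝ) * 2 := by
    refine norm_sum_le_of_le _ fun k hk => ?_
    have hk0 : (1 : ℝ) ≤ k := by exact_mod_cast Nat.pos_of_mem_divisors hk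
    rw [norm_mul, norm_div, norm_natCast, norm_natCast]
    gcongr
    · exact div_le_self (Nat.cast_nonneg _) hk0
    · refine (norm_add_le _ _).trans ?_
      rw [norm_zpow, norm_zpow, norm_xi, one_zpow, one_zpow]
      norm_num
  refine h.trans ?_
  rw [Finset.sum_const, nsmul_eq_mul]
  have : (d.divisors.card : ℝ) ≤ d := by exact_mod_cast Nat.card_divisors_le_self d
  nlinarith [Nat.cast_nonneg (α := ℝ) d]

lemma differentiableOn_tsum_tCoeff (p : ℕ) (a : ℤ) :
    DifferentiableOn ℂ (fun x : ℂ => ∑' d : ℕ+, x ^ (d : ℕ) * tCoeff p a d) (Metric.ball 0 1) := by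
  intro x hx
  rw [mem_ball_zero_iff] at hx
  obtain ⟨r, hr1, hr2⟩ := exists_between hx
  have hr0 : 0 ≤ r := (norm_nonneg _).trans hr1.le
  have hs : Summable fun d : ℕ+ => 2 * ((d : ℝ) ^ 2 * r ^ (d : ℕ)) := by
    have := summable_pow_mul_geometric_of_norm_lt_one 2 (r := r)
      (by rwa [Real.norm_of_nonneg hr0])
    exact (this.comp_injective PNat.coe_injective).mul_left 2
  have hd := differentiableOn_tsum_of_summable_norm (U := Metric.ball (0 : ℂ) r)
    (F := fun (d : ℕ+) (x : ℂ) => x ^ (d : ℕ) * tCoeff p a d) hs (fun d => by fun_prop)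
    Metric.isOpen_ball (fun d w hw => by
      rw [mem_ball_zero_iff] at hw
      rw [norm_mul, norm_pow]
      calc ‖w‖ ^ (d : ℕ) * ‖tCoeff p a d‖ ≤ r ^ (d : ℕ) * (2 * (d : ℝ) ^ 2) := by
            gcongr
            exact norm_tCoeff_le p a d
        _ = _ := by ring)
  exact (hd.differentiableAt (Metric.isOpen_ball.mem_nhds
    (mem_ball_zero_iff.2 hr1))).differentiableWithinAt

variable {p : ℕ} {a : ℤ}

lemma t_eq_tsum (hp : p ≠ 0) (ha : ¬ (p : ℤ) ∣ a) (τ : ℍ) :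
    t p a τ = 1 / 12 - ∑' d : ℕ+, tTerm p a τ d := by
  rw [(hasSum_tTerm hp ha τ).tsum_eq]; ring

lemma mdifferentiable_t (hp : p ≠ 0) (ha : ¬ (p : ℤ) ∣ a) : MDiff (t p a) := by
  rw [UpperHalfPlane.mdifferentiable_iff]
  have hm : Set.MapsTo (fun z : ℂ => exp (2 * π * I * z)) {z | 0 < z.im} (Metric.ball 0 1) :=
    fun z hz => by
      rw [mem_ball_zero_iff]
      exact UpperHalfPlane.norm_exp_two_pi_I_lt_one ⟨z, hz⟩
  have h := ((differentiableOn_tsum_tCoeff p a).comp (by fun_prop) hm).const_sub (1 / 12)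
  refine h.congr fun z hz => ?_
  rw [Function.comp_apply, UpperHalfPlane.ofComplex_apply_of_im_pos hz, t_eq_tsum hp ha]
  rfl

/-- The coefficients are at most 2d² ≤ 4·binom(d+2, 2), and the binomials sum to (1-r)⁻³, with
1/(1-r) ≤ 1 + 1/Im τ because exp(2πy) ≥ 1 + y. The 5 is this 4 plus 1 for the constant term. -/
lemma norm_t_le (hp : p ≠ 0) (ha : ¬ (p : ℤ) ∣ a) (τ : ℍ) :
    ‖t p a τ‖ ≤ 5 * (1 + 1 / τ.im) ^ 3 := by
  have hy := τ.im_pos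
  set r := ‖q τ‖ with hr
  have hr0 : 0 ≤ r := norm_nonneg _
  have hr1 : r < 1 := norm_q_lt_one τ
  have hre : r = Real.exp (-(2 * π * τ.im)) := by
    rw [hr, q, norm_exp]
    congr 1
    simp
  have hinv : 1 / (1 - r) ≤ 1 + 1 / τ.im := by
    have h1 : r * (1 + τ.im) ≤ 1 := by
      have h2 : 1 + τ.im ≤ Real.exp (2 * π * τ.im) := by
        have := Real.add_one_le_exp (2 * π * τ.im)
        nlinarith [Real.pi_gt_three]
      calc r * (1 + τ.im) ≤ r * Real.exp (2 * π * τ.im) := by gcongr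
        _ = 1 := by rw [hre, ← Real.exp_add]; simp
    rw [div_le_iff₀ (by linarith)]
    have : (1 + 1 / τ.im) * (1 - r) = 1 + (1 - r * (1 + τ.im)) / τ.im := by field_simp; ring
    rw [this]
    have : 0 ≤ (1 - r * (1 + τ.im)) / τ.im := div_nonneg (by linarith) hy.le
    linarith
  have hs : HasSum (fun n : ℕ => ((n + 2).choose 2 : ℝ) * r ^ n) (1 / (1 - r) ^ 3) :=
    hasSum_choose_mul_geometric_of_norm_lt_one 2 (by rwa [Real.norm_of_nonneg hr0])
  have hle : ∀ d : ℕ+, ‖tTerm p a τ d‖ ≤ 4 * (((d : ℕ) + 2).choose 2 * r ^ (d : ℕ)) := fun d => by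
    have h1 : tTerm p a τ d = q τ ^ (d : ℕ) * tCoeff p a d := rfl
    rw [h1, norm_mul, norm_pow]
    have h2 := norm_tCoeff_le p a d
    have h3 : (((d : ℕ) + 2).choose 2 : ℝ) = (((d : ℕ) : ℝ) + 2) * ((d : ℕ) + 1) / 2 := by
      rw [Nat.cast_choose_two]; push_cast; ring
    have h4 : 2 * ((d : ℕ) : ℝ) ^ 2 ≤ 4 * (((d : ℕ) + 2).choose 2 : ℝ) := by
      rw [h3]; nlinarith [Nat.cast_nonneg (α := ℝ) (d : ℕ)]
    calc r ^ (d : ℕ) * ‖tCoeff p a d‖ ≤ r ^ (d : ℕ) * (4 * (((d : ℕ) + 2).choose 2 : ℝ)) := by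
          gcongr; exact h2.trans h4
      _ = _ := by ring
  have hsum : ‖∑' d : ℕ+, tTerm p a τ d‖ ≤ 4 * (1 / (1 - r) ^ 3) := by
    have hs' : Summable fun d : ℕ+ => 4 * ((((d : ℕ) + 2).choose 2 : ℝ) * r ^ (d : ℕ)) :=
      (hs.summable.comp_injective PNat.coe_injective).mul_left 4
    refine (tsum_of_norm_bounded hs'.hasSum hle).trans ?_
    rw [tsum_mul_left, ← hs.tsum_eq]
    gcongr
    exact hs.summable.tsum_subtype_le _ {n | 0 < n} (fun n => by positivity)
  have h1 : (1 / (1 - r)) ^ 3 ≤ (1 + 1 / τ.im) ^ 3 := by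
    have : 0 < 1 - r := by linarith
    gcongr
  have h2 : (1 : ℝ) ≤ (1 + 1 / τ.im) ^ 3 := one_le_pow₀ (by
    have : 0 < 1 / τ.im := by positivity
    linarith)
  rw [t_eq_tsum hp ha]
  refine (norm_sub_le _ _).trans ?_
  have h3 : ‖(1 / 12 : ℂ)‖ ≤ 1 := by norm_num
  rw [div_pow, one_pow] at h1
  linarith

lemma t_slash (hp : p ≠ 0) (ha : ¬ (p : ℤ) ∣ a) {γ : SL(2, ℤ)}
    (hγ : γ ∈ CongruenceSubgroup.Gamma1 p) : t p a ∣[(2 : ℤ)] γ = t p a := by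
  funext τ
  rw [ModularForm.slash_action_eq'_iff, t_smul hp ha hγ]
  norm_cast

/-- `t_a` as a modular form of weight two for `Γ₁(p)`. -/
def tModularForm (hp : p ≠ 0) (ha : ¬ (p : ℤ) ∣ a) :
    ModularForm (CongruenceSubgroup.Gamma1 p : Subgroup (GL (Fin 2) ℝ)) 2 where
  toFun := t p a
  slash_action_eq' := by
    rintro _ ⟨γ, hγ, rfl⟩
    exact t_slash hp ha hγ
  holo' := mdifferentiable_t hp ha
  bdd_at_cusps' {c} hc := by
    have : NeZero p := ⟨hp⟩
    rw [Subgroup.IsArithmetic.isCusp_iff_isCusp_SL2Z] at hc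
    rw [OnePoint.isBoundedAt_iff_forall_SL2Z hc]
    exact fun γ _ => isBoundedAtImInfty_slash (Nat.pos_of_ne_zero hp) (mdifferentiable_t hp ha)
      (fun γ hγ => t_slash hp ha hγ) (by norm_num) (norm_t_le hp ha) γ

/-! ### Classes modulo p, parity and the relation for s_a and t_a. -/

lemma s_congr {p : ℕ} (hp : p ≠ 0) {a a' : ℤ} (h : a ≡ a' [ZMOD (p : ℤ)]) : s p a = s p a' := by
  obtain ⟨m, hm⟩ := h.dvd
  have hp' : (p : ℂ) ≠ 0 := by exact_mod_cast hp
  have e : (a' / p : ℂ) = a / p + m := by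
    rw [eq_add_of_sub_eq' hm]; push_cast; field_simp
  funext τ
  rw [s, s, e, logDeriv_theta_add_int]

lemma t_congr {p : ℕ} (hp : p ≠ 0) {a a' : ℤ} (h : a ≡ a' [ZMOD (p : ℤ)]) : t p a = t p a' := by
  obtain ⟨m, hm⟩ := h.dvd
  have hp' : (p : ℂ) ≠ 0 := by exact_mod_cast hp
  have e : (a' / p : ℂ) = a / p + m := by
    rw [eq_add_of_sub_eq' hm]; push_cast; field_simp
  funext τ
  rw [t_eq_tFun, t_eq_tFun, e, tFun_add_int]

lemma t_neg (p : ℕ) (a : ℤ) (τ : ℍ) : t p (-a) τ = t p a τ := by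
  rw [t_eq_tFun, t_eq_tFun, Int.cast_neg, neg_div, tFun_neg]

lemma s_neg (p : ℕ) (a : ℤ) (τ : ℍ) : s p (-a) τ = -s p a τ := by
  rw [s, s, Int.cast_neg, neg_div, logDeriv_theta_neg, mul_neg]

/-- Replace c by -(a+b); since s is odd and t even in the index, this is the three-term relation at
x = a/p, y = b/p. -/
lemma s_t_quadratic {p : ℕ} (hp : p ≠ 0) {a b c : ℤ} (ha : ¬ (p : ℤ) ∣ a) (hb : ¬ (p : ℤ) ∣ b)
    (hc : ¬ (p : ℤ) ∣ c) (h : a + b + c ≡ 0 [ZMOD (p : ℤ)]) (τ : ℍ) :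
    s p a τ * s p b τ + s p b τ * s p c τ + s p c τ * s p a τ +
      t p a τ + t p b τ + t p c τ = 0 := by
  have hcab : c ≡ -(a + b) [ZMOD (p : ℤ)] := by
    have := h.sub_right (a + b)
    rwa [add_sub_cancel_left, zero_sub] at this
  have hab : ¬ (p : ℤ) ∣ a + b := fun hd => hc (by
    rw [← dvd_neg, ← Int.modEq_zero_iff_dvd] at hd
    exact Int.modEq_zero_iff_dvd.1 (hcab.trans hd))
  rw [s_congr hp hcab, t_congr hp hcab, s_neg, t_neg]
  have e : ((a + b : ℤ) / p : ℂ) = a / p + b / p := by push_cast; ring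
  have hl : ∀ {x : ℤ}, ¬ (p : ℤ) ∣ x → (x / p : ℂ) ∉ lattice τ :=
    fun hx => (div_mem_lattice_iff hp).not.2 hx
  simp only [t_eq_tFun]
  have hab' := hl hab
  rw [e] at hab' ⊢
  exact logDeriv_theta_quadratic (hl ha) (hl hb) hab' rfl rfl (by rw [s, e])

end ThetaForms
end

theorem mainTheorem7 (p : ℕ) (hp : p.Prime) (hp2 : p ≠ 2) :
    -- the quotients and derivatives in the definitions of `s_a` and `t_a` make sense
    (∀ τ : ℍ, Differentiable ℂ (fun z : ℂ => ThetaForms.theta z τ) ∧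
      deriv (fun z : ℂ => ThetaForms.theta z τ) 0 ≠ 0 ∧
      ∀ a : ℤ, ¬ (p : ℤ) ∣ a → ThetaForms.theta ((a : ℂ) / (p : ℂ)) τ ≠ 0) ∧
    -- `s_a` and `t_a` depend only on the class of `a` in `(ℤ / p)^*`
    (∀ a a' : ℤ, ¬ (p : ℤ) ∣ a → a ≡ a' [ZMOD (p : ℤ)] →
      ThetaForms.s p a = ThetaForms.s p a' ∧ ThetaForms.t p a = ThetaForms.t p a') ∧
    -- `t_a` is a modular form of weight two for `Γ₁(p)`
    (∀ a : ℤ, ¬ (p : ℤ) ∣ a →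
      ∃ f : ModularForm (CongruenceSubgroup.Gamma1 p : Subgroup (GL (Fin 2) ℝ)) 2,
        ∀ τ : ℍ, f τ = ThetaForms.t p a τ) ∧
    -- the `q`-expansion of `t_a`
    (∀ a : ℤ, ¬ (p : ℤ) ∣ a → ∀ τ : ℍ,
      Summable (ThetaForms.tTerm p a τ) ∧
      ThetaForms.t p a τ = 1 / 12 - ∑' d : ℕ+, ThetaForms.tTerm p a τ d) ∧
    -- the quadratic relations
    (∀ a b c : ℤ, ¬ (p : ℤ) ∣ a → ¬ (p : ℤ) ∣ b → ¬ (p : ℤ) ∣ c →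
      a + b + c ≡ 0 [ZMOD (p : ℤ)] → ∀ τ : ℍ,
      ThetaForms.s p a τ * ThetaForms.s p b τ + ThetaForms.s p b τ * ThetaForms.s p c τ +
          ThetaForms.s p c τ * ThetaForms.s p a τ +
        ThetaForms.t p a τ + ThetaForms.t p b τ + ThetaForms.t p c τ = 0) ∧
    -- the symmetry of the `t_a`
    (∀ a : ℤ, ¬ (p : ℤ) ∣ a → ∀ τ : ℍ, ThetaForms.t p (-a) τ = ThetaForms.t p a τ) := by
  have hp0 := hp.ne_zero
  refine ⟨fun τ => ⟨ThetaForms.differentiable_theta τ, ThetaForms.deriv_theta_zero_ne_zero τ,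
    fun a ha => ThetaForms.theta_eq_zero_iff.not.2 ((ThetaForms.div_mem_lattice_iff hp0).not.2 ha)⟩,
    fun a a' _ h => ⟨ThetaForms.s_congr hp0 h, ThetaForms.t_congr hp0 h⟩,
    fun a ha => ⟨ThetaForms.tModularForm hp0 ha, fun τ => rfl⟩,
    fun a ha τ => ⟨(ThetaForms.hasSum_tTerm hp0 ha τ).summable, ThetaForms.t_eq_tsum hp0 ha τ⟩,
    fun a b c ha hb hc h τ => ThetaForms.s_t_quadratic hp0 ha hb hc h τ,
    fun a _ τ => ThetaForms.t_neg p a τ⟩
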